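/- All Banach spaces and algebras are complex. A contractive approximate identity (cai) of a Banach algebra $A$ is a net $(e_\lambda)$ in $A$ with $\|e_\lambda\|\le 1$ and $e_\lambda a\to a$, $ae_\lambda\to a$ for all $a\in A$. $M(A)$ is the algebra of double centralizers $T=(L,R)$ of $A$ (bounded maps with $R(a)b=aL(b)$), and we write $Ta=L(a)$, $aT=R(a)$; $\iota_A\colon A\to M(A)$ is $\iota_A(a)=(b\mapsto ab,\ b\mapsto ba)$. If $A$ has a cai, every nondegenerate bounded representation $\pi\colon A\to\mathcal B(E)$ on a Banach space extends uniquely to $\widehat\pi\colon M(A)\to\mathcal B(E)$ with $\widehat\pi(T)\pi(a)=\pi(Ta)$. Let $G$ be a locally compact (Hausdorff) group with left Haar measure $dx$ and modular function $\Delta$, normalized by $\int\psi(xy)\,dx=\Delta(y^{-1})\int\psi(x)\,dx$, and let $A$ be a Banach algebra with a cai. A twisted action of $G$ on $A$ is a pair $(\alpha,\sigma)$ of maps, $\alpha$ from $G$ to the isometric automorphisms of $A$ and $\sigma$ from $G\times G$ to the invertible $u\in M(A)$ with $\|u\|=\|u^{-1}\|=1$, such that for all $a\in A$ and $x,y,z\in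 G$: $x\mapsto\alpha_x(a)$, $(x,y)\mapsto\sigma_{x,y}a$ and $(x,y)\mapsto a\sigma_{x,y}$ are continuous; $\alpha_1=\mathrm{id}$; $\sigma_{1,x}=\sigma_{x,1}=1$; $\alpha_x(\alpha_y(a))=\sigma_{x,y}\alpha_{xy}(a)\sigma_{x,y}^{-1}$; and $\alpha_z(\sigma_{x,y})\sigma_{z,xy}=\sigma_{z,x}\sigma_{zx,y}$ (with $\alpha_z$ extended to $M(A)$). A covariant representation of $(G,A,\alpha,\sigma)$ on a Banach space $E$ is a pair $(\pi,u)$ of a nondegenerate bounded representation $\pi$ of $A$ on $E$ and a strongly continuous map $u$ from $G$ to the invertible isometries of $E$ such that $u_xu_y=\widehat\pi(\sigma_{x,y})u_{xy}$ and $\pi(\alpha_x(a))=u_x\pi(a)u_x^{-1}$; it is contractive if $\|\pi\|\le1$. Its integrated form is $(\pi\rtimes u)(f)=\int_G\pi(f(x))u_x\,dx$ (strong integral) for $f\in L^1(G;A)$. $L^1(G,A,\alpha,\sigma)$ is $L^1(G;A)$ with the product $(f*g)(x)=\int_G f(y)\alpha_y(g(y^{-1}x))\sigma_{y,y^{-1}x}\,dy$.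 Let $\mathcal R$ be a nonempty class of contractive covariant representations of $(G,A,\alpha,\sigma)$, put $\|f\|_{\mathcal R}=\sup\{\|(\pi\rtimes u)(f)\|:(\pi,u)\in\mathcal R\}$, and let $F_{\mathcal R}=F_{\mathcal R}(G,A,\alpha,\sigma)$ be the Banach algebra obtained as the Hausdorff completion of $L^1(G,A,\alpha,\sigma)$ in this seminorm. Let $(\lambda_A^{\mathcal R},\rho_A^{\mathcal R})\colon A\to M(F_{\mathcal R})$ and $(\lambda_G^{\mathcal R},\rho_G^{\mathcal R})\colon G\to M(F_{\mathcal R})$ be the maps induced by the operators $(\lambda_A(a)f)(x)=af(x)$, $(\rho_A(a)f)(x)=f(x)\alpha_x(a)$, $(\lambda_G(y)f)(x)=\alpha_y(f(y^{-1}x))\sigma_{y,y^{-1}x}$ and $(\rho_G(y)f)(x)=f(xy^{-1})\sigma_{xy^{-1},y}\Delta(y^{-1})$ on $L^1(G;A)$. **Theorem.** Let $B$ be a Banach algebra with a cai (so that $B$ is nondegenerately and isometrically represented on itself by left multiplication), and let $M(B)$ act on the Banach space $B$ by $b\mapsto Tb$. Suppose there are maps $k_A\colon A\to M(B)$ and $k_G\colon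 G\to M(B)$ such that 1. $(k_A,k_G)$ is a covariant representation of $(G,A,\alpha,\sigma)$ on $B$; 2. $(k_A\rtimes k_G)(L^1(G,A,\alpha,\sigma))$ is a dense subset of $\iota_B(B)$; 3. $\|(k_A\rtimes k_G)(f)\|=\|f\|_{\mathcal R}$ for all $f\in L^1(G,A,\alpha,\sigma)$. Then there is a unique isometric Banach algebra isomorphism $\Psi\colon F_{\mathcal R}(G,A,\alpha,\sigma)\to B$ whose extension $\widehat\Psi\colon M(F_{\mathcal R})\to M(B)$, $\widehat\Psi(T)\Psi(c)=\Psi(Tc)$, $\Psi(c)\widehat\Psi(T)=\Psi(cT)$, satisfies $$k_A=\widehat\Psi\circ(\lambda_A^{\mathcal R},\rho_A^{\mathcal R}),\qquad k_G=\widehat\Psi\circ(\lambda_G^{\mathcal R},\rho_G^{\mathcal R}).$$ -/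

import Mathlib

open MeasureTheory Filter Topology
open scoped MultiplierAlgebra NNReal

universe w

noncomputable section

set_option linter.unusedSectionVars false

namespace TwistedBanach

/-- A normed algebra has a contractive approximate identity (cai). The net is encoded by a proper
filter: a net gives the filter of its tails, and conversely every proper filter is the filter of
tails of a net. -/
class HasCAI (A : Type*) [NonUnitalNormedRing A] : Prop where
  exists_cai : ∃ l : Filter A, l.NeBot ∧ (∀ᶠ e in l, ‖e‖ ≤ 1) ∧
    (∀ a : A, Tendsto (fun e => e * a) l (𝓝 a)) ∧ (∀ a : A, Tendsto (fun e => a * e) l (𝓝 a))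

section Algebra

variable {A : Type*} [NonUnitalNormedRing A] [NormedSpace ℂ A] [IsScalarTower ℂ A A]
  [SMulCommClass ℂ A A]
variable {B : Type*} [NonUnitalNormedRing B] [NormedSpace ℂ B] [IsScalarTower ℂ B B]
  [SMulCommClass ℂ B B]

/-- Isometric isomorphisms of Banach algebras. -/
structure IsometricIso (A B : Type*) [NonUnitalNormedRing A] [NormedSpace ℂ A]
    [NonUnitalNormedRing B] [NormedSpace ℂ B] extends A ≃ₗᵢ[ℂ] B where
  map_mul' : ∀ a b : A, toLinearIsometryEquiv (a * b) =
    toLinearIsometryEquiv a * toLinearIsometryEquiv b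

instance : CoeFun (IsometricIso A B) (fun _ => A → B) := ⟨fun Ψ => Ψ.toLinearIsometryEquiv⟩

/-- The underlying bounded linear map of an isometric isomorphism. -/
def IsometricIso.toCLM (Ψ : IsometricIso A B) : A →L[ℂ] B :=
  Ψ.toLinearIsometryEquiv.toContinuousLinearEquiv.toContinuousLinearMap

/-- The inverse of an isometric isomorphism as a bounded linear map. -/
def IsometricIso.invCLM (Ψ : IsometricIso A B) : B →L[ℂ] A :=
  Ψ.toLinearIsometryEquiv.symm.toContinuousLinearEquiv.toContinuousLinearMap

/-- The extension `Ψ̂ : M(A) → M(B)` of an isometric isomorphism `Ψ : A → B` to the algebras of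
double centralizers: `Ψ̂(T) Ψ(a) = Ψ(T a)` and `Ψ(a) Ψ̂(T) = Ψ(a T)`. -/
def IsometricIso.hat (Ψ : IsometricIso A B) (T : 𝓜(ℂ, A)) : 𝓜(ℂ, B) where
  fst := Ψ.toCLM ∘L T.fst ∘L Ψ.invCLM
  snd := Ψ.toCLM ∘L T.snd ∘L Ψ.invCLM
  central := by
    intro x y
    obtain ⟨a, rfl⟩ := Ψ.toLinearIsometryEquiv.surjective x
    obtain ⟨b, rfl⟩ := Ψ.toLinearIsometryEquiv.surjective y
    simp [IsometricIso.toCLM, IsometricIso.invCLM, ← Ψ.map_mul', T.central]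

theorem IsometricIso.hat_fst_apply (Ψ : IsometricIso A B) (T : 𝓜(ℂ, A)) (a : A) :
    (Ψ.hat T).fst (Ψ a) = Ψ (T.fst a) := by
  simp [IsometricIso.hat, IsometricIso.toCLM, IsometricIso.invCLM]

theorem IsometricIso.hat_snd_apply (Ψ : IsometricIso A B) (T : 𝓜(ℂ, A)) (a : A) :
    (Ψ.hat T).snd (Ψ a) = Ψ (T.snd a) := by
  simp [IsometricIso.hat, IsometricIso.toCLM, IsometricIso.invCLM]

theorem fst_mul_apply [HasCAI A] (T : 𝓜(ℂ, A)) (a b : A) : T.fst (a * b) = T.fst a * b := by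
  obtain ⟨l, hl, -, h1, -⟩ := HasCAI.exists_cai (A := A)
  have e1 := h1 (T.fst (a * b))
  have e2 := h1 (T.fst a * b)
  refine tendsto_nhds_unique e1 (e2.congr fun e => ?_)
  rw [← T.central, ← mul_assoc, ← mul_assoc, T.central]

/-- A nondegenerate representation of a Banach algebra `A` on a Banach space `E`: a bounded algebra
homomorphism `π : A → B(E)` for which the span of the vectors `π(a)ξ` is dense. -/
structure NondegRep (A E : Type*) [NonUnitalNormedRing A] [NormedSpace ℂ A]
    [NormedAddCommGroup E] [NormedSpace ℂ E] where
  toCLM : A →L[ℂ] E →L[ℂ] E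
  map_mul' : ∀ a b : A, toCLM (a * b) = toCLM a ∘L toCLM b
  nondegenerate : Dense (Submodule.span ℂ {η : E | ∃ a ξ, toCLM a ξ = η} : Set E)

instance {A E : Type*} [NonUnitalNormedRing A] [NormedSpace ℂ A]
    [NormedAddCommGroup E] [NormedSpace ℂ E] : CoeFun (NondegRep A E) (fun _ => A → E →L[ℂ] E) := ⟨fun π => π.toCLM⟩

theorem NondegRep.ext_on {A E : Type*} [NonUnitalNormedRing A] [NormedSpace ℂ A]
    [NormedAddCommGroup E] [NormedSpace ℂ E] (π : NondegRep A E) {F : Type*} [NormedAddCommGroup F] [NormedSpace ℂ F]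
    {S T : E →L[ℂ] F} (h : ∀ a ξ, S (π a ξ) = T (π a ξ)) : S = T := by
  refine ContinuousLinearMap.ext_on π.nondegenerate ?_
  rintro _ ⟨a, ξ, rfl⟩
  exact h a ξ

variable {E : Type*} [NormedAddCommGroup E] [NormedSpace ℂ E]

theorem NondegRep.existsUnique_hat [CompleteSpace E] [HasCAI A] (π : NondegRep A E)
    (T : 𝓜(ℂ, A)) : ∃! S : E →L[ℂ] E, ∀ a ξ, S (π a ξ) = π (T.fst a) ξ := by
  obtain ⟨l, hl, hb, h1, -⟩ := HasCAI.exists_cai (A := A)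
  set C : ℝ := ‖π.toCLM‖ * ‖T.fst‖ with hC
  have hC0 : 0 ≤ C := by positivity
  have hbd : ∀ᶠ e in l, ∀ ξ, ‖π (T.fst e) ξ‖ ≤ C * ‖ξ‖ := by
    filter_upwards [hb] with e he ξ
    calc ‖π (T.fst e) ξ‖ ≤ ‖π (T.fst e)‖ * ‖ξ‖ := ContinuousLinearMap.le_opNorm _ _
      _ ≤ (‖π.toCLM‖ * (‖T.fst‖ * ‖e‖)) * ‖ξ‖ := by
        gcongr
        exact (π.toCLM.le_opNorm _).trans (by gcongr; exact T.fst.le_opNorm _)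
      _ ≤ (‖π.toCLM‖ * (‖T.fst‖ * 1)) * ‖ξ‖ := by gcongr
      _ = C * ‖ξ‖ := by rw [hC, mul_one]
  have hgen : ∀ a ξ, Tendsto (fun e => π (T.fst e) (π a ξ)) l (𝓝 (π (T.fst a) ξ)) := by
    intro a ξ
    have h2 : Tendsto (fun e => π (T.fst (e * a)) ξ) l (𝓝 (π (T.fst a) ξ)) :=
      (((π.toCLM.flip ξ).continuous.comp T.fst.continuous).tendsto a).comp (h1 a)
    refine h2.congr fun e => ?_
    rw [fst_mul_apply, π.map_mul']
    rfl
  have hspan : ∀ v ∈ Submodule.span ℂ {η : E | ∃ a ξ, π.toCLM a ξ = η},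
      ∃ w, Tendsto (fun e => π (T.fst e) v) l (𝓝 w) := by
    intro v hv
    induction hv using Submodule.span_induction with
    | mem x h => obtain ⟨a, ξ, rfl⟩ := h; exact ⟨_, hgen a ξ⟩
    | zero => exact ⟨0, by simp⟩
    | add x y _ _ hx hy =>
      obtain ⟨w, hw⟩ := hx
      obtain ⟨w', hw'⟩ := hy
      exact ⟨w + w', by simpa using hw.add hw'⟩
    | smul c x _ hx =>
      obtain ⟨w, hw⟩ := hx
      exact ⟨c • w, by simpa using hw.const_smul c⟩
  have hall : ∀ v, ∃ w, Tendsto (fun e => π (T.fst e) v) l (𝓝 w) := by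
    intro v
    refine CompleteSpace.complete (f := map (fun e => π (T.fst e) v) l) ?_
    rw [Metric.cauchy_iff]
    refine ⟨inferInstance, fun ε hε => ?_⟩
    obtain ⟨v', hv', hd⟩ := Metric.mem_closure_iff.1 (π.nondegenerate v) (ε / 4 / (C + 1))
      (by positivity)
    obtain ⟨w, hw⟩ := hspan v' hv'
    refine ⟨Metric.ball w (ε / 2), ?_, ?_⟩
    · have h3 : ∀ᶠ e in l, dist (π (T.fst e) v') w < ε / 4 :=
        Metric.tendsto_nhds.1 hw _ (by positivity)
      rw [mem_map]
      filter_upwards [h3, hbd] with e he1 he2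
      have : dist (π (T.fst e) v) (π (T.fst e) v') ≤ ε / 4 := by
        rw [dist_eq_norm, ← map_sub]
        refine (he2 _).trans ?_
        rw [← dist_eq_norm]
        calc C * dist v v' ≤ (C + 1) * (ε / 4 / (C + 1)) := by gcongr; linarith
          _ = ε / 4 := by field_simp
      show dist _ _ < _
      linarith [dist_triangle (π (T.fst e) v) (π (T.fst e) v') w]
    · intro x hx y hy
      rw [Metric.mem_ball] at hx hy
      linarith [dist_triangle_right x y w]
  choose S hS using hall
  let S' : E →ₗ[ℂ] E :=
    { toFun := S
      map_add' := fun x y => tendsto_nhds_unique (hS (x + y))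
        (by simpa using (hS x).add (hS y))
      map_smul' := fun c x => tendsto_nhds_unique (hS (c • x))
        (by simpa using (hS x).const_smul c) }
  let S'' : E →L[ℂ] E := S'.mkContinuous C fun v =>
    le_of_tendsto (hS v).norm (hbd.mono fun e he => he v)
  have hS'' : ∀ a ξ, S'' (π a ξ) = π (T.fst a) ξ := fun a ξ =>
    tendsto_nhds_unique (hS (π a ξ)) (hgen a ξ)
  exact ⟨S'', hS'', fun S₂ h₂ => π.ext_on fun a ξ => by rw [h₂, hS'']⟩

/-- The extension `π̂ : M(A) → B(E)` of a nondegenerate representation `π` to the multiplier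
algebra: `π̂(T)` is the only bounded operator on `E` with `π̂(T) π(a) ξ = π(T a) ξ` for all `a`, `ξ`,
where `T a = T.fst a`. -/
def NondegRep.hat [CompleteSpace E] [HasCAI A] (π : NondegRep A E) (T : 𝓜(ℂ, A)) : E →L[ℂ] E :=
  (π.existsUnique_hat T).choose

theorem NondegRep.hat_apply [CompleteSpace E] [HasCAI A] (π : NondegRep A E) (T : 𝓜(ℂ, A))
    (a : A) (ξ : E) : π.hat T (π a ξ) = π (T.fst a) ξ :=
  (π.existsUnique_hat T).choose_spec.1 a ξ

theorem NondegRep.apply_hat [CompleteSpace E] [HasCAI A] (π : NondegRep A E) (T : 𝓜(ℂ, A))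
    (a : A) (ξ : E) : π a (π.hat T ξ) = π (T.snd a) ξ := by
  have : (π a) ∘L (π.hat T) = π (T.snd a) := π.ext_on fun b η => by
    rw [ContinuousLinearMap.comp_apply, π.hat_apply]
    have h := T.central a b
    have h1 := congrArg (fun S => S η) (π.map_mul' a (T.fst b))
    have h2 := congrArg (fun S => S η) (π.map_mul' (T.snd a) b)
    simp only [ContinuousLinearMap.comp_apply] at h1 h2
    rw [← h1, ← h2, h]
  exact congrArg (fun S => S ξ) this

end Algebra

section Systems

/-- A twisted action `(α, σ)` of `G` on `A`. Here `u.fst a = u a` and `u.snd a = a u` for `a : A` and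
a multiplier `u`; in particular `u⁻¹.snd (u.fst a) = u a u⁻¹ = Ad(u) a`. -/
structure TwistedAction (G A : Type*) [Group G] [TopologicalSpace G] [NonUnitalNormedRing A]
    [NormedSpace ℂ A] [IsScalarTower ℂ A A] [SMulCommClass ℂ A A] where
  α : G → IsometricIso A A
  σ : G → G → (𝓜(ℂ, A))ˣ
  norm_σ : ∀ x y, ‖(σ x y : 𝓜(ℂ, A))‖ = 1
  norm_σ_inv : ∀ x y, ‖((σ x y)⁻¹ : (𝓜(ℂ, A))ˣ).val‖ = 1
  continuous_α : ∀ a : A, Continuous fun x => α x a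
  continuous_σ_mul : ∀ a : A, Continuous fun p : G × G => (σ p.1 p.2 : 𝓜(ℂ, A)).fst a
  continuous_mul_σ : ∀ a : A, Continuous fun p : G × G => (σ p.1 p.2 : 𝓜(ℂ, A)).snd a
  α_one : ∀ a : A, α 1 a = a
  σ_one_left : ∀ x, (σ 1 x : 𝓜(ℂ, A)) = 1
  σ_one_right : ∀ x, (σ x 1 : 𝓜(ℂ, A)) = 1
  α_comp : ∀ x y (a : A), α x (α y a) =
    ((σ x y)⁻¹ : (𝓜(ℂ, A))ˣ).val.snd ((σ x y : 𝓜(ℂ, A)).fst (α (x * y) a))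
  cocycle : ∀ x y z, (α z).hat (σ x y : 𝓜(ℂ, A)) * (σ z (x * y) : 𝓜(ℂ, A)) =
    (σ z x : 𝓜(ℂ, A)) * (σ (z * x) y : 𝓜(ℂ, A))

variable {G : Type*} [Group G] [TopologicalSpace G]
variable {A : Type*} [NonUnitalNormedRing A] [NormedSpace ℂ A] [IsScalarTower ℂ A A]
  [SMulCommClass ℂ A A]

/-- A covariant representation `(π, u)` of `(G, A, α, σ)` on the Banach space `E`. -/
structure CovariantRep [HasCAI A] (S : TwistedAction G A) (E : Type*) [NormedAddCommGroup E]
    [NormedSpace ℂ E] [CompleteSpace E] where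
  π : NondegRep A E
  u : G → E ≃ₗᵢ[ℂ] E
  continuous_u : ∀ ξ : E, Continuous fun x => u x ξ
  u_mul : ∀ x y (ξ : E), u x (u y ξ) = π.hat (S.σ x y : 𝓜(ℂ, A)) (u (x * y) ξ)
  covariant : ∀ x (a : A) (ξ : E), π (S.α x a) ξ = u x (π a ((u x).symm ξ))

/-- A covariant representation together with the Banach space on which it acts. -/
structure BundledCovariantRep.{w', u₁, u₂} {G : Type u₁} [Group G] [TopologicalSpace G]
    {A : Type u₂} [NonUnitalNormedRing A] [NormedSpace ℂ A] [IsScalarTower ℂ A A]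
    [SMulCommClass ℂ A A] [HasCAI A] (S : TwistedAction G A) where
  E : Type w'
  [instNormedAddCommGroup : NormedAddCommGroup E]
  [instNormedSpace : NormedSpace ℂ E]
  [instCompleteSpace : CompleteSpace E]
  rep : CovariantRep S E

attribute [instance] BundledCovariantRep.instNormedAddCommGroup
  BundledCovariantRep.instNormedSpace BundledCovariantRep.instCompleteSpace

end Systems

section L1

variable {G : Type*} [Group G] [TopologicalSpace G] [IsTopologicalGroup G] [LocallyCompactSpace G]
  [MeasurableSpace G] [BorelSpace G]
variable {A : Type*} [NormedAddCommGroup A] [NormedSpace ℂ A]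

theorem continuous_uncurry_of_bound {X E F : Type*} [TopologicalSpace X] [NormedAddCommGroup E]
    [NormedSpace ℂ E] [NormedAddCommGroup F] [NormedSpace ℂ F] (Φ : X → E →L[ℂ] F)
    (hΦ : ∀ a, Continuous fun x => Φ x a) (C : ℝ) (hC : ∀ x, ‖Φ x‖ ≤ C) :
    Continuous fun p : X × E => Φ p.1 p.2 := by
  rw [continuous_iff_continuousAt]
  rintro ⟨x, a⟩
  have h1 : Tendsto (fun p : X × E => Φ p.1 a) (𝓝 (x, a)) (𝓝 (Φ x a)) :=
    ((hΦ a).tendsto x).comp (continuous_fst.tendsto (x, a))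
  have h2 : Tendsto (fun p : X × E => Φ p.1 (p.2 - a)) (𝓝 (x, a)) (𝓝 0) := by
    have h3 : Tendsto (fun p : X × E => C * ‖p.2 - a‖) (𝓝 (x, a)) (𝓝 0) := by
      have : Continuous fun p : X × E => C * ‖p.2 - a‖ := by fun_prop
      simpa using this.tendsto (x, a)
    refine squeeze_zero_norm (fun p => ?_) h3
    exact (ContinuousLinearMap.le_opNorm _ _).trans (by gcongr; exact hC _)
  have h4 := h1.add h2
  rw [add_zero] at h4
  exact h4.congr fun p => by simp

theorem exists_cc_approx {ν : Measure G} [ν.Regular] {f : G → A} (hf : MemLp f 1 ν) {ε : ENNReal}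
    (hε : ε ≠ 0) : ∃ g : G → A, eLpNorm (f - g) 1 ν ≤ ε ∧ Continuous g ∧ HasCompactSupport g := by
  refine hf.induction_dense ENNReal.one_ne_top _ ?_ ?_ ?_ hε
  · intro c t ht htν ε hε
    obtain ⟨δ, δpos, hδ⟩ := exists_Lp_half A ν 1 hε
    obtain ⟨η, ηpos, hη⟩ := exists_eLpNorm_indicator_le (μ := ν) ENNReal.one_ne_top c δpos.ne'
    have hη_pos' : (0 : ENNReal) < η := ENNReal.coe_pos.2 ηpos
    obtain ⟨s, st, s_compact, s_closed, νs⟩ :=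
      ht.exists_isCompact_isClosed_sdiff_lt htν.ne hη_pos'.ne'
    have hsν : ν s < ⊤ := (measure_mono st).trans_lt htν
    obtain ⟨V, sV, V_open, -, hV⟩ := s_closed.measurableSet.exists_isOpen_sdiff_lt hsν.ne hη_pos'.ne'
    obtain ⟨g, hgs, hgV, hgc, hg_range⟩ := exists_continuous_one_zero_of_isCompact s_compact
      V_open.isClosed_compl (Set.disjoint_compl_right_iff_subset.2 sV)
    have g_norm : ∀ x, ‖g x‖ = g x := fun x => by
      rw [Real.norm_eq_abs, abs_of_nonneg (hg_range x).1]
    have gcc : HasCompactSupport fun x => g x • c := hgc.smul_right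
    have gcont : Continuous fun x => g x • c := by fun_prop
    have I1 : eLpNorm ((s.indicator fun _ => c) - t.indicator fun _ => c) 1 ν ≤ δ := by
      rw [← eLpNorm_neg, neg_sub, ← Set.indicator_sdiff st]
      exact hη _ νs.le
    have I2 : eLpNorm ((fun x => g x • c) - s.indicator fun _ => c) 1 ν ≤ δ := by
      refine (eLpNorm_mono fun x => ?_).trans (hη (V \ s) hV.le)
      by_cases hs : x ∈ s
      · have h1 : g x = 1 := hgs hs
        simp [hs, h1]
      · by_cases hv : x ∈ V
        · simp only [Pi.sub_apply, hs, not_false_eq_true, Set.indicator_of_notMem, sub_zero,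
            norm_smul, g_norm]
          rw [Set.indicator_of_mem (show x ∈ V \ s from ⟨hv, hs⟩)]
          exact mul_le_of_le_one_left (norm_nonneg _) (hg_range x).2
        · have h1 : g x = 0 := hgV hv
          simp [hs, h1]
    refine ⟨fun x => g x • c, ?_, gcont, gcc⟩
    have h3 := hδ _ _
      ((gcont.stronglyMeasurable_of_hasCompactSupport gcc).aestronglyMeasurable.sub
        (aestronglyMeasurable_const.indicator s_closed.measurableSet))
      ((aestronglyMeasurable_const.indicator s_closed.measurableSet).sub
        (aestronglyMeasurable_const.indicator ht)) I2 I1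
    rw [sub_add_sub_cancel] at h3
    exact h3.le
  · rintro f g ⟨f_cont, hf⟩ ⟨g_cont, hg⟩
    exact ⟨f_cont.add g_cont, hf.add hg⟩
  · rintro f ⟨f_cont, hf⟩
    exact (f_cont.stronglyMeasurable_of_hasCompactSupport hf).aestronglyMeasurable

theorem aestronglyMeasurable_fiber {E : Type*} [NormedAddCommGroup E] [NormedSpace ℂ E]
    {ν : Measure G} [ν.Regular] (Φ : G → A →L[ℂ] E)
    (hΦ : ∀ a, Continuous fun x => Φ x a) (C : ℝ) (hC : ∀ x, ‖Φ x‖ ≤ C) {f : G → A}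
    (hf : Integrable f ν) : AEStronglyMeasurable (fun x => Φ x (f x)) ν := by
  have hcont := continuous_uncurry_of_bound Φ hΦ C hC
  have hn : ∀ n : ℕ, ∃ g : G → A, HasCompactSupport g ∧
      eLpNorm (f - g) 1 ν ≤ ENNReal.ofReal (1 / ((n : ℝ) + 1)) ∧ Continuous g := by
    intro n
    obtain ⟨g, h1, h2, h3⟩ := exists_cc_approx (memLp_one_iff_integrable.2 hf)
      (ε := ENNReal.ofReal (1 / ((n : ℝ) + 1))) (by simp; positivity)
    exact ⟨g, h3, h1, h2⟩
  choose g h1 h2 h3 using hn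
  have hlim : Tendsto (fun n => eLpNorm (g n - f) 1 ν) atTop (𝓝 0) := by
    have h5 : Tendsto (fun n : ℕ => ENNReal.ofReal (1 / ((n : ℝ) + 1))) atTop (𝓝 0) := by
      simpa using ENNReal.tendsto_ofReal tendsto_one_div_add_atTop_nhds_zero_nat
    refine tendsto_of_tendsto_of_tendsto_of_le_of_le tendsto_const_nhds h5 (fun _ => zero_le) ?_
    intro n
    show eLpNorm (g n - f) 1 ν ≤ _
    rw [eLpNorm_sub_comm]
    exact h2 n
  have hg : ∀ n, AEStronglyMeasurable (g n) ν := fun n =>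
    ((h3 n).stronglyMeasurable_of_hasCompactSupport (h1 n)).aestronglyMeasurable
  have hm := tendstoInMeasure_of_tendsto_eLpNorm (p := 1) one_ne_zero hg hf.aestronglyMeasurable hlim
  obtain ⟨ns, -, hns⟩ := hm.exists_seq_tendsto_ae
  refine aestronglyMeasurable_of_tendsto_ae atTop (f := fun n x => Φ x (g (ns n) x)) ?_ ?_
  · intro n
    have hc : Continuous fun x => Φ x (g (ns n) x) :=
      hcont.comp (continuous_id.prodMk (h3 (ns n)))
    refine (hc.stronglyMeasurable_of_hasCompactSupport ?_).aestronglyMeasurable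
    refine (h1 (ns n)).mono ?_
    intro x hx
    rw [Function.mem_support] at hx ⊢
    exact fun h => hx (by rw [h, map_zero])
  · filter_upwards [hns] with x hx
    exact ((Φ x).continuous.tendsto _).comp hx

theorem integrable_fiber {E : Type*} [NormedAddCommGroup E] [NormedSpace ℂ E]
    {ν : Measure G} [ν.Regular] (Φ : G → A →L[ℂ] E)
    (hΦ : ∀ a, Continuous fun x => Φ x a) (C : ℝ) (hC : ∀ x, ‖Φ x‖ ≤ C) {f : G → A}
    (hf : Integrable f ν) : Integrable (fun x => Φ x (f x)) ν := by
  refine (hf.norm.const_mul C).mono' (aestronglyMeasurable_fiber Φ hΦ C hC hf) ?_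
  exact Eventually.of_forall fun x =>
    (ContinuousLinearMap.le_opNorm _ _).trans (by gcongr; exact hC _)

theorem integrable_fiber_comp {E : Type*} [NormedAddCommGroup E] [NormedSpace ℂ E]
    {ν : Measure G} [ν.Regular] (θ : G ≃ₜ G) (c : ℝ≥0) (hθ : ν.map θ = c • ν) (Φ : G → A →L[ℂ] E)
    (hΦ : ∀ a, Continuous fun x => Φ x a) (C : ℝ) (hC : ∀ x, ‖Φ x‖ ≤ C) {f : G → A}
    (hf : Integrable f ν) : Integrable (fun x => Φ (θ x) (f (θ x))) ν := by
  have h : Integrable (fun x => Φ x (f x)) (ν.map θ) := by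
    rw [hθ]
    exact (integrable_fiber Φ hΦ C hC hf).smul_measure_nnreal
  exact (integrable_map_equiv θ.toMeasurableEquiv _).1 h

theorem ae_comp {G : Type*} [TopologicalSpace G] [MeasurableSpace G] [BorelSpace G] {ν : Measure G} (θ : G ≃ₜ G) (c : ℝ≥0) (hθ : ν.map θ = c • ν) {p : G → Prop}
    (h : ∀ᵐ x ∂ν, p x) : ∀ᵐ x ∂ν, p (θ x) := by
  have h' : ∀ᵐ x ∂(ν.map θ), p x := by
    rw [hθ]
    exact Measure.ae_smul_measure h c
  exact ae_of_ae_map θ.continuous.measurable.aemeasurable h'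

theorem integral_comp {G : Type*} [TopologicalSpace G] [MeasurableSpace G] [BorelSpace G] {ν : Measure G} {E : Type*} [NormedAddCommGroup E] [NormedSpace ℝ E]
    (θ : G ≃ₜ G) (c : ℝ≥0) (hθ : ν.map θ = c • ν) (g : G → E) :
    ∫ x, g (θ x) ∂ν = (c : ℝ) • ∫ x, g x ∂ν := by
  have := integral_map_equiv (μ := ν) θ.toMeasurableEquiv g
  rw [← NNReal.smul_def, ← integral_smul_nnreal_measure, ← hθ]
  exact this.symm

/-- The bounded operator `f ↦ (x ↦ Φ_{θ(x)}(f(θ(x))))` on `L¹(G; A)`, for a homeomorphism `θ` of `G`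
that scales the measure by a constant, and a bounded strongly continuous family `Φ`. -/
def fiberOp (ν : Measure G) [ν.Regular] (θ : G ≃ₜ G) (c : ℝ≥0) (hθ : ν.map θ = c • ν)
    (Φ : G → A →L[ℂ] A) (hΦ : ∀ a, Continuous fun x => Φ x a) (C : ℝ) (hC : ∀ x, ‖Φ x‖ ≤ C) :
    Lp A 1 ν →L[ℂ] Lp A 1 ν :=
  LinearMap.mkContinuous
    { toFun := fun f => (integrable_fiber_comp θ c hθ Φ hΦ C hC (L1.integrable_coeFn f)).toL1 _
      map_add' := fun f g => by
        rw [← Integrable.toL1_add]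
        rw [Integrable.toL1_eq_toL1_iff]
        filter_upwards [ae_comp θ c hθ (Lp.coeFn_add f g)] with x hx
        simp only [Pi.add_apply] at hx ⊢
        rw [hx, map_add]
      map_smul' := fun k f => by
        rw [RingHom.id_apply, ← Integrable.toL1_smul]
        rw [Integrable.toL1_eq_toL1_iff]
        filter_upwards [ae_comp θ c hθ (Lp.coeFn_smul k f)] with x hx
        simp only [Pi.smul_apply] at hx ⊢
        rw [hx, map_smul] }
    (c * C) (fun f => by
      have h0 : (0 : ℝ) ≤ c := c.2
      have hi := L1.integrable_coeFn f
      show ‖Integrable.toL1 _ (integrable_fiber_comp θ c hθ Φ hΦ C hC hi)‖ ≤ _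
      rw [L1.norm_of_fun_eq_integral_norm, integral_comp θ c hθ (fun x => ‖Φ x (f x)‖), smul_eq_mul,
        mul_assoc, L1.norm_eq_integral_norm, ← integral_const_mul C]
      refine mul_le_mul_of_nonneg_left ?_ h0
      refine integral_mono (integrable_fiber Φ hΦ C hC hi).norm (hi.norm.const_mul C) fun x => ?_
      exact (ContinuousLinearMap.le_opNorm _ _).trans (by gcongr; exact hC _))

theorem fiberOp_coeFn (ν : Measure G) [ν.Regular] (θ : G ≃ₜ G) (c : ℝ≥0) (hθ : ν.map θ = c • ν)
    (Φ : G → A →L[ℂ] A) (hΦ : ∀ a, Continuous fun x => Φ x a) (C : ℝ) (hC : ∀ x, ‖Φ x‖ ≤ C)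
    (f : Lp A 1 ν) : fiberOp ν θ c hθ Φ hΦ C hC f =ᵐ[ν] fun x => Φ (θ x) (f (θ x)) :=
  Integrable.coeFn_toL1 (integrable_fiber_comp θ c hθ Φ hΦ C hC (L1.integrable_coeFn f))

theorem norm_fiberOp_apply_le (ν : Measure G) [ν.Regular] (θ : G ≃ₜ G) (c : ℝ≥0)
    (hθ : ν.map θ = c • ν) (Φ : G → A →L[ℂ] A) (hΦ : ∀ a, Continuous fun x => Φ x a) (C : ℝ)
    (hC : ∀ x, ‖Φ x‖ ≤ C) (f : Lp A 1 ν) : ‖fiberOp ν θ c hθ Φ hΦ C hC f‖ ≤ c * C * ‖f‖ := by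
  have h0 : 0 ≤ (c : ℝ) * C := mul_nonneg c.2 ((norm_nonneg _).trans (hC 1))
  exact (ContinuousLinearMap.le_opNorm _ _).trans
    (mul_le_mul_of_nonneg_right (LinearMap.mkContinuous_norm_le _ h0 _) (norm_nonneg _))

/-- The operator-valued integral `f ↦ ∫ P(f(x)) U_x dx`, taken in the strong sense
`ξ ↦ ∫ P(f(x)) U_x ξ dx`. -/
def integratedForm (ν : Measure G) [ν.Regular] {E : Type*} [NormedAddCommGroup E] [NormedSpace ℂ E]
    (P : A →L[ℂ] E →L[ℂ] E) (U : G → E →L[ℂ] E) (hU : ∀ ξ, Continuous fun x => U x ξ)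
    (hU1 : ∀ x ξ, ‖U x ξ‖ ≤ ‖ξ‖) : Lp A 1 ν →L[ℂ] E →L[ℂ] E :=
  have hc : ∀ ξ a, Continuous fun x => P.flip (U x ξ) a := fun ξ a => (P a).continuous.comp (hU ξ)
  have hb : ∀ ξ x, ‖P.flip (U x ξ)‖ ≤ ‖P‖ * ‖ξ‖ := fun ξ x => by
    refine (P.flip.le_opNorm _).trans ?_
    rw [ContinuousLinearMap.opNorm_flip]
    gcongr
    exact hU1 x ξ
  have hint : ∀ (f : Lp A 1 ν) ξ, Integrable (fun x => P (f x) (U x ξ)) ν := fun f ξ =>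
    integrable_fiber (fun x => P.flip (U x ξ)) (hc ξ) _ (hb ξ) (L1.integrable_coeFn f)
  LinearMap.mkContinuous₂
    (LinearMap.mk₂ ℂ (fun (f : Lp A 1 ν) (ξ : E) => ∫ x, P (f x) (U x ξ) ∂ν)
      (fun f g ξ => by
        rw [← integral_add (hint f ξ) (hint g ξ)]
        refine integral_congr_ae ?_
        filter_upwards [Lp.coeFn_add f g] with x hx
        rw [hx, Pi.add_apply, map_add, add_apply])
      (fun k f ξ => by
        rw [← integral_smul]
        refine integral_congr_ae ?_
        filter_upwards [Lp.coeFn_smul k f] with x hx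
        rw [hx, Pi.smul_apply, map_smul, smul_apply])
      (fun f ξ η => by
        rw [← integral_add (hint f ξ) (hint f η)]
        simp)
      (fun k f ξ => by
        rw [← integral_smul]
        simp))
    ‖P‖ (fun f ξ => by
      simp only [LinearMap.mk₂_apply]
      refine (norm_integral_le_integral_norm _).trans ?_
      have : ‖P‖ * ‖f‖ * ‖ξ‖ = ∫ x, ‖P‖ * ‖ξ‖ * ‖f x‖ ∂ν := by
        rw [integral_const_mul, L1.norm_eq_integral_norm]; ring
      rw [this]
      refine integral_mono (hint f ξ).norm ((L1.integrable_coeFn f).norm.const_mul _) fun x => ?_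
      exact ((P.flip (U x ξ)).le_opNorm (f x)).trans
        (mul_le_mul_of_nonneg_right (hb ξ x) (norm_nonneg _)))

theorem integratedForm_apply (ν : Measure G) [ν.Regular] {E : Type*} [NormedAddCommGroup E]
    [NormedSpace ℂ E] (P : A →L[ℂ] E →L[ℂ] E) (U : G → E →L[ℂ] E)
    (hU : ∀ ξ, Continuous fun x => U x ξ) (hU1 : ∀ x ξ, ‖U x ξ‖ ≤ ‖ξ‖) (f : Lp A 1 ν) (ξ : E) :
    integratedForm ν P U hU hU1 f ξ = ∫ x, P (f x) (U x ξ) ∂ν := rfl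

theorem integrable_integratedForm (ν : Measure G) [ν.Regular] {E : Type*} [NormedAddCommGroup E]
    [NormedSpace ℂ E] (P : A →L[ℂ] E →L[ℂ] E) (U : G → E →L[ℂ] E)
    (hU : ∀ ξ, Continuous fun x => U x ξ) (hU1 : ∀ x ξ, ‖U x ξ‖ ≤ ‖ξ‖) (f : Lp A 1 ν) (ξ : E) :
    Integrable (fun x => P (f x) (U x ξ)) ν := by
  refine integrable_fiber (fun x => P.flip (U x ξ)) (fun a => (P a).continuous.comp (hU ξ))
    (‖P‖ * ‖ξ‖) (fun x => ?_) (L1.integrable_coeFn f)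
  refine (P.flip.le_opNorm _).trans ?_
  rw [ContinuousLinearMap.opNorm_flip]
  gcongr
  exact hU1 x ξ

theorem norm_integratedForm_le (ν : Measure G) [ν.Regular] {E : Type*} [NormedAddCommGroup E]
    [NormedSpace ℂ E] (P : A →L[ℂ] E →L[ℂ] E) (U : G → E →L[ℂ] E)
    (hU : ∀ ξ, Continuous fun x => U x ξ) (hU1 : ∀ x ξ, ‖U x ξ‖ ≤ ‖ξ‖) :
    ‖integratedForm ν P U hU hU1‖ ≤ ‖P‖ := by
  unfold integratedForm
  exact LinearMap.mkContinuous₂_norm_le _ (norm_nonneg P) _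

end L1

section Operators

variable {G : Type*} [Group G] [TopologicalSpace G] [IsTopologicalGroup G] [LocallyCompactSpace G]
  [MeasurableSpace G] [BorelSpace G]
variable {A : Type*} [NonUnitalNormedRing A] [NormedSpace ℂ A] [IsScalarTower ℂ A A]
  [SMulCommClass ℂ A A]

theorem norm_snd_le (T : 𝓜(ℂ, A)) : ‖T.snd‖ ≤ ‖T‖ := by
  rw [DoubleCentralizer.norm_def]
  exact _root_.norm_snd_le (DoubleCentralizer.toProdHom T)

theorem IsometricIso.norm_apply (Ψ : IsometricIso A A) (a : A) : ‖Ψ a‖ = ‖a‖ :=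
  Ψ.toLinearIsometryEquiv.norm_map a

theorem TwistedAction.norm_σ_snd_apply_le (S : TwistedAction G A) (x y : G) (a : A) :
    ‖(S.σ x y : 𝓜(ℂ, A)).snd a‖ ≤ ‖a‖ := by
  refine (ContinuousLinearMap.le_opNorm _ _).trans ?_
  refine (mul_le_mul_of_nonneg_right (norm_snd_le _) (norm_nonneg _)).trans ?_
  rw [S.norm_σ, one_mul]

/-- The modular function `Δ` of `G`, with `∫ ψ(xy) dx = Δ(y⁻¹) ∫ ψ(x) dx`. -/
def modular (y : G) : ℝ≥0 := Measure.modularCharacterFun y⁻¹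

theorem map_mulRight_eq (ν : Measure G) [ν.IsHaarMeasure] [ν.Regular] (y : G) :
    ν.map (Homeomorph.mulRight y) = modular y⁻¹ • ν := by
  rw [modular, inv_inv, Measure.modularCharacterFun_eq_haarScalarFactor ν]
  have : (ν.map (Homeomorph.mulRight y)).Regular := Measure.Regular.map _
  have : (ν.map (Homeomorph.mulRight y)).IsMulLeftInvariant :=
    inferInstanceAs (ν.map (· * y)).IsMulLeftInvariant
  have : (ν.map (Homeomorph.mulRight y)).IsHaarMeasure :=
    inferInstanceAs (ν.map (· * y)).IsHaarMeasure
  exact Measure.isMulLeftInvariant_eq_smul_of_regular _ ν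

theorem modular_mul_inv (y : G) : modular y * modular y⁻¹ = 1 := by
  rw [modular, modular, ← Measure.modularCharacterFun_map_mul, inv_inv, inv_mul_cancel,
    Measure.modularCharacterFun_map_one]

/-- `(λ_A(a) f)(x) = a f(x)`. -/
def lamA (ν : Measure G) [ν.Regular] (a : A) : Lp A 1 ν →L[ℂ] Lp A 1 ν :=
  fiberOp ν (Homeomorph.refl G) 1 (by simp) (fun _ => ContinuousLinearMap.mul ℂ A a)
    (fun _ => continuous_const) ‖a‖ (fun _ => ContinuousLinearMap.opNorm_mul_apply_le ℂ A a)

/-- `(ρ_A(a) f)(x) = f(x) α_x(a)`. -/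
def rhoA (ν : Measure G) [ν.Regular] (S : TwistedAction G A) (a : A) :
    Lp A 1 ν →L[ℂ] Lp A 1 ν :=
  fiberOp ν (Homeomorph.refl G) 1 (by simp)
    (fun x => (ContinuousLinearMap.mul ℂ A).flip (S.α x a))
    (fun b => continuous_const.mul (S.continuous_α a)) ‖a‖ (fun x =>
      ContinuousLinearMap.opNorm_le_bound _ (norm_nonneg _) fun b => by
        rw [ContinuousLinearMap.flip_apply, ContinuousLinearMap.mul_apply', mul_comm ‖a‖,
          ← (S.α x).norm_apply a]
        exact norm_mul_le _ _)

/-- `(λ_G(y) f)(x) = α_y(f(y⁻¹x)) σ(y, y⁻¹x)`. -/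
def lamG (ν : Measure G) [ν.IsHaarMeasure] [ν.Regular] (S : TwistedAction G A) (y : G) :
    Lp A 1 ν →L[ℂ] Lp A 1 ν :=
  fiberOp ν (Homeomorph.mulLeft y⁻¹) 1 (by simpa using map_mul_left_eq_self ν y⁻¹)
    (fun z => (S.σ y z : 𝓜(ℂ, A)).snd ∘L (S.α y).toCLM)
    (fun a => (S.continuous_mul_σ (S.α y a)).comp (Continuous.prodMk_right y)) 1 (fun z =>
      ContinuousLinearMap.opNorm_le_bound _ zero_le_one fun a => by
        rw [one_mul]
        exact (S.norm_σ_snd_apply_le y z _).trans ((S.α y).norm_apply a).le)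

/-- `(ρ_G(y) f)(x) = f(xy⁻¹) σ(xy⁻¹, y) Δ(y⁻¹)`. -/
def rhoG (ν : Measure G) [ν.IsHaarMeasure] [ν.Regular] (S : TwistedAction G A) (y : G) :
    Lp A 1 ν →L[ℂ] Lp A 1 ν :=
  fiberOp ν (Homeomorph.mulRight y⁻¹) (modular y) (by simpa using map_mulRight_eq ν y⁻¹)
    (fun z => ((modular y⁻¹ : ℝ) : ℂ) • (S.σ z y : 𝓜(ℂ, A)).snd)
    (fun a => ((S.continuous_mul_σ a).comp (Continuous.prodMk_left y)).const_smul _)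
    (modular y⁻¹) (fun z =>
      ContinuousLinearMap.opNorm_le_bound _ (NNReal.coe_nonneg _) fun a => by
        rw [smul_apply, norm_smul, Complex.norm_real, Real.norm_eq_abs, NNReal.abs_eq]
        gcongr
        exact S.norm_σ_snd_apply_le z y a)

theorem lamA_coeFn (ν : Measure G) [ν.Regular] (a : A) (f : Lp A 1 ν) :
    lamA ν a f =ᵐ[ν] fun x => a * f x :=
  fiberOp_coeFn ν _ _ _ _ _ _ _ f

theorem rhoA_coeFn (ν : Measure G) [ν.Regular] (S : TwistedAction G A) (a : A) (f : Lp A 1 ν) :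
    rhoA ν S a f =ᵐ[ν] fun x => f x * S.α x a :=
  fiberOp_coeFn ν _ _ _ _ _ _ _ f

theorem lamG_coeFn (ν : Measure G) [ν.IsHaarMeasure] [ν.Regular] (S : TwistedAction G A) (y : G)
    (f : Lp A 1 ν) :
    lamG ν S y f =ᵐ[ν] fun x => (S.σ y (y⁻¹ * x) : 𝓜(ℂ, A)).snd (S.α y (f (y⁻¹ * x))) :=
  fiberOp_coeFn ν _ _ _ _ _ _ _ f

theorem rhoG_coeFn (ν : Measure G) [ν.IsHaarMeasure] [ν.Regular] (S : TwistedAction G A) (y : G)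
    (f : Lp A 1 ν) :
    rhoG ν S y f =ᵐ[ν] fun x =>
      ((modular y⁻¹ : ℝ) : ℂ) • (S.σ (x * y⁻¹) y : 𝓜(ℂ, A)).snd (f (x * y⁻¹)) :=
  fiberOp_coeFn ν _ _ _ _ _ _ _ f

/-- `λ_A` as a bounded linear map `A → B(L¹(G; A))`. -/
def lamACLM (ν : Measure G) [ν.Regular] : A →L[ℂ] Lp A 1 ν →L[ℂ] Lp A 1 ν :=
  LinearMap.mkContinuous
    { toFun := lamA ν
      map_add' := fun a b => by
        ext1 f
        apply Lp.ext
        filter_upwards [lamA_coeFn ν (a + b) f, lamA_coeFn ν a f, lamA_coeFn ν b f,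
          Lp.coeFn_add (lamA ν a f) (lamA ν b f)] with x h1 h2 h3 h4
        rw [h1, add_apply, h4, Pi.add_apply, h2, h3, add_mul]
      map_smul' := fun k a => by
        ext1 f
        apply Lp.ext
        filter_upwards [lamA_coeFn ν (k • a) f, lamA_coeFn ν a f,
          Lp.coeFn_smul k (lamA ν a f)] with x h1 h2 h3
        rw [h1, RingHom.id_apply, smul_apply, h3, Pi.smul_apply, h2, smul_mul_assoc] }
    1 (fun a => by
      refine ContinuousLinearMap.opNorm_le_bound _ (by positivity) fun f => ?_
      have := norm_fiberOp_apply_le ν (Homeomorph.refl G) 1 (by simp)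
        (fun _ => ContinuousLinearMap.mul ℂ A a) (fun _ => continuous_const) ‖a‖
        (fun _ => ContinuousLinearMap.opNorm_mul_apply_le ℂ A a) f
      exact this.trans_eq (by simp))

theorem norm_lamG_apply_le (ν : Measure G) [ν.IsHaarMeasure] [ν.Regular] (S : TwistedAction G A)
    (y : G) (f : Lp A 1 ν) : ‖lamG ν S y f‖ ≤ ‖f‖ := by
  have := norm_fiberOp_apply_le ν (Homeomorph.mulLeft y⁻¹) 1
    (by simpa using map_mul_left_eq_self ν y⁻¹)
    (fun z => (S.σ y z : 𝓜(ℂ, A)).snd ∘L (S.α y).toCLM)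
    (fun a => (S.continuous_mul_σ (S.α y a)).comp (Continuous.prodMk_right y)) 1 (fun z =>
      ContinuousLinearMap.opNorm_le_bound _ zero_le_one fun a => by
        rw [one_mul]
        exact (S.norm_σ_snd_apply_le y z _).trans ((S.α y).norm_apply a).le) f
  exact this.trans_eq (by simp)

theorem TwistedAction.continuous_twist (S : TwistedAction G A) {g : G → A} (hg : Continuous g) :
    Continuous fun p : G × G =>
      (S.σ p.1 (p.1⁻¹ * p.2) : 𝓜(ℂ, A)).snd (S.α p.1 (g (p.1⁻¹ * p.2))) := by
  have h1 : Continuous fun q : G × A => S.α q.1 q.2 :=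
    continuous_uncurry_of_bound (fun y => (S.α y).toCLM) S.continuous_α 1 fun y =>
      ContinuousLinearMap.opNorm_le_bound _ zero_le_one fun a => by
        rw [one_mul]; exact ((S.α y).norm_apply a).le
  have h2 : Continuous fun q : (G × G) × A => (S.σ q.1.1 q.1.2 : 𝓜(ℂ, A)).snd q.2 :=
    continuous_uncurry_of_bound (fun p : G × G => (S.σ p.1 p.2 : 𝓜(ℂ, A)).snd)
      S.continuous_mul_σ 1 fun p => ContinuousLinearMap.opNorm_le_bound _ zero_le_one fun a => by
        rw [one_mul]; exact S.norm_σ_snd_apply_le _ _ a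
  have h3 : Continuous fun p : G × G => p.1⁻¹ * p.2 := by fun_prop
  exact h2.comp ((continuous_fst.prodMk h3).prodMk
    (h1.comp (continuous_fst.prodMk (hg.comp h3))))

theorem continuous_lamG (ν : Measure G) [ν.IsHaarMeasure] [ν.Regular] (S : TwistedAction G A)
    (f : Lp A 1 ν) : Continuous fun y => lamG ν S y f := by
  -- first the images of continuous functions with compact support
  have hcc : ∀ (g : G → A), Continuous g → HasCompactSupport g → ∀ g' : Lp A 1 ν, g' =ᵐ[ν] g →
      Continuous fun y => lamG ν S y g' := by
    intro g hg hgs g' hg'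
    set H : G → G → A := fun y x => (S.σ y (y⁻¹ * x) : 𝓜(ℂ, A)).snd (S.α y (g (y⁻¹ * x))) with hH
    have hHc : Continuous fun p : G × G => H p.1 p.2 := S.continuous_twist hg
    have hHe : ∀ y, lamG ν S y g' =ᵐ[ν] H y := fun y => by
      have := (measurePreserving_mul_left ν y⁻¹).quasiMeasurePreserving.ae hg'
      filter_upwards [lamG_coeFn ν S y g', this] with x h1 h2
      rw [h1, h2]
    rw [continuous_iff_continuousAt]
    intro y₀
    rw [ContinuousAt, tendsto_iff_norm_sub_tendsto_zero]
    obtain ⟨V, hV, hVn⟩ := exists_compact_mem_nhds y₀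
    have hn : ∀ y, ‖lamG ν S y g' - lamG ν S y₀ g'‖ = ∫ x, ‖H y x - H y₀ x‖ ∂ν := by
      intro y
      rw [L1.norm_eq_integral_norm]
      refine integral_congr_ae ?_
      filter_upwards [Lp.coeFn_sub (lamG ν S y g') (lamG ν S y₀ g'), hHe y, hHe y₀]
        with x h1 h2 h3
      rw [h1, Pi.sub_apply, h2, h3]
    simp_rw [hn]
    have hco : ContinuousOn (fun y => ∫ x, ‖H y x - H y₀ x‖ ∂ν) V := by
      refine continuousOn_integral_of_compact_support
        (f := fun y x => ‖H y x - H y₀ x‖) (k := (fun p : G × G => p.1 * p.2) '' (V ×ˢ tsupport g))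
        ((hV.prod hgs).image continuous_mul) ?_ ?_
      · have h1 : Continuous fun p : G × G => H y₀ p.2 :=
          hHc.comp (continuous_const.prodMk continuous_snd)
        exact (hHc.sub h1).norm.continuousOn
      · have h0 : ∀ y x, y ∈ V → x ∉ (fun p : G × G => p.1 * p.2) '' (V ×ˢ tsupport g) →
            H y x = 0 := by
          intro y x hy hx
          have : g (y⁻¹ * x) = 0 := by
            by_contra h
            exact hx ⟨(y, y⁻¹ * x), ⟨hy, subset_tsupport g h⟩, by simp⟩
          have h' : S.α y (0 : A) = 0 := (S.α y).toLinearIsometryEquiv.map_zero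
          rw [hH]
          simp only [this, h', map_zero]
        intro y x hy hx
        rw [h0 y x hy hx, h0 y₀ x (mem_of_mem_nhds hVn) hx, sub_zero, norm_zero]
    have := (hco.continuousAt hVn).tendsto
    simpa using this
  rw [continuous_iff_continuousAt]
  intro y₀
  rw [Metric.continuousAt_iff']
  intro ε hε
  obtain ⟨g, h1, h2, h3⟩ := exists_cc_approx (Lp.memLp f) (ε := ENNReal.ofReal (ε / 4))
    (by simpa using hε)
  have hgm : MemLp g 1 ν := h2.memLp_of_hasCompactSupport h3
  have hfg : ‖f - hgm.toLp g‖ ≤ ε / 4 := by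
    rw [Lp.norm_def]
    refine ENNReal.toReal_le_of_le_ofReal (by positivity) ?_
    refine le_trans (le_of_eq (eLpNorm_congr_ae ?_)) h1
    filter_upwards [Lp.coeFn_sub f (hgm.toLp g), hgm.coeFn_toLp] with x h4 h5
    rw [h4, Pi.sub_apply, h5, Pi.sub_apply]
  have hc := (hcc g h2 h3 _ hgm.coeFn_toLp).continuousAt (x := y₀)
  rw [Metric.continuousAt_iff'] at hc
  filter_upwards [hc (ε / 4) (by positivity)] with y hy
  have h6 : ∀ z, dist (lamG ν S z f) (lamG ν S z (hgm.toLp g)) ≤ ε / 4 := fun z => by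
    rw [dist_eq_norm, ← map_sub]
    exact (norm_lamG_apply_le ν S z _).trans hfg
  have h7 := h6 y
  have h8 := h6 y₀
  rw [dist_comm] at h8
  have h9 := dist_triangle4 (lamG ν S y f) (lamG ν S y (hgm.toLp g)) (lamG ν S y₀ (hgm.toLp g))
    (lamG ν S y₀ f)
  linarith

/-- The twisted convolution `(f * g)(x) = ∫ f(y) α_y(g(y⁻¹x)) σ(y, y⁻¹x) dy` on `L¹(G; A)`. Since
`(λ_A(f(y)) λ_G(y) g)(x) = f(y) α_y(g(y⁻¹x)) σ(y, y⁻¹x)`, it is written as the `L¹(G; A)`-valued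
Bochner integral `f * g = ∫ λ_A(f(y)) λ_G(y) g dy`, which needs no countability assumption on `G`;
`conv_coeFn_of_hasCompactSupport` gives the pointwise formula on the dense subspace `C_c(G, A)`. -/
def conv (ν : Measure G) [ν.IsHaarMeasure] [ν.Regular] (S : TwistedAction G A) :
    Lp A 1 ν →L[ℂ] Lp A 1 ν →L[ℂ] Lp A 1 ν :=
  integratedForm ν (lamACLM ν) (lamG ν S) (continuous_lamG ν S) (norm_lamG_apply_le ν S)

theorem conv_apply (ν : Measure G) [ν.IsHaarMeasure] [ν.Regular] (S : TwistedAction G A)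
    (f g : Lp A 1 ν) : conv ν S f g = ∫ y, lamA ν (f y) (lamG ν S y g) ∂ν := rfl

/-- On continuous functions with compact support, `conv` is the twisted convolution
`(f * g)(x) = ∫ f(y) α_y(g(y⁻¹x)) σ(y, y⁻¹x) dy`. -/
theorem conv_coeFn_of_hasCompactSupport [CompleteSpace A] (ν : Measure G) [ν.IsHaarMeasure]
    [ν.Regular] (S : TwistedAction G A) {f g : G → A} (hf : Continuous f)
    (hfs : HasCompactSupport f) (hg : Continuous g) (hgs : HasCompactSupport g) {f' g' : Lp A 1 ν}
    (hf' : f' =ᵐ[ν] f) (hg' : g' =ᵐ[ν] g) :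
    conv ν S f' g' =ᵐ[ν] fun x =>
      ∫ y, f y * (S.σ y (y⁻¹ * x) : 𝓜(ℂ, A)).snd (S.α y (g (y⁻¹ * x))) ∂ν := by
  set H : G → G → A :=
    fun y x => f y * (S.σ y (y⁻¹ * x) : 𝓜(ℂ, A)).snd (S.α y (g (y⁻¹ * x))) with hH
  have hHc : Continuous H.uncurry :=
    (hf.comp continuous_fst).mul (S.continuous_twist hg)
  have hH1 : ∀ y x, y ∉ tsupport f → H y x = 0 := fun y x hy => by
    rw [hH]; simp only; rw [image_eq_zero_of_notMem_tsupport hy, zero_mul]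
  set M : Set G := (fun p : G × G => p.1 * p.2) '' (tsupport f ×ˢ tsupport g) with hM
  have hMc : IsCompact M := (hfs.prod hgs).image continuous_mul
  have hH2 : ∀ y x, x ∉ M → H y x = 0 := by
    intro y x hx
    by_cases hy : y ∈ tsupport f
    · have h1 : g (y⁻¹ * x) = 0 := by
        by_contra h
        exact hx ⟨(y, y⁻¹ * x), ⟨hy, subset_tsupport g h⟩, by simp⟩
      have h' : S.α y (0 : A) = 0 := (S.α y).toLinearIsometryEquiv.map_zero
      rw [hH]
      simp only [h1, h', map_zero, mul_zero]
    · exact hH1 y x hy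
  have hHs : HasCompactSupport H.uncurry := by
    refine HasCompactSupport.intro' (hfs.prod hMc.closure)
      ((isClosed_tsupport f).prod isClosed_closure) ?_
    rintro ⟨y, x⟩ hyx
    by_cases hy : y ∈ tsupport f
    · exact hH2 y x fun hx => hyx ⟨hy, subset_closure hx⟩
    · exact hH1 y x hy
  have hPc : Continuous fun x => ∫ y, H y x ∂ν := by
    rw [← continuousOn_univ]
    refine continuousOn_integral_of_compact_support (f := fun x y => H y x) hfs ?_
      (fun x y _ hy => hH1 y x hy)
    exact (hHc.comp continuous_swap).continuousOn
  have hPi : Integrable (fun x => ∫ y, H y x ∂ν) ν := by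
    refine hPc.integrable_of_hasCompactSupport
      (HasCompactSupport.intro' hMc.closure isClosed_closure fun x hx => ?_)
    have : ∀ y, H y x = 0 := fun y => hH2 y x fun h => hx (subset_closure h)
    simp [this]
  have hlam : ∀ y, lamA ν (f y) (lamG ν S y g') =ᵐ[ν] H y := fun y => by
    have := (measurePreserving_mul_left ν y⁻¹).quasiMeasurePreserving.ae hg'
    filter_upwards [lamA_coeFn ν (f y) (lamG ν S y g'), lamG_coeFn ν S y g', this] with x h1 h2 h3
    rw [h1, h2, h3]
  have hi : Integrable (fun y => lamA ν (f' y) (lamG ν S y g')) ν :=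
    integrable_integratedForm ν (lamACLM ν) (lamG ν S) (continuous_lamG ν S)
      (norm_lamG_apply_le ν S) f' g'
  refine Integrable.ae_eq_of_forall_setIntegral_eq _ _ (L1.integrable_coeFn _) hPi fun s hs _ => ?_
  let T : Lp A 1 ν →L[ℝ] A := (L1.integralCLM (μ := ν.restrict s)) ∘L (LpToLpRestrictCLM G A ℝ ν 1 s)
  have hT : ∀ h : Lp A 1 ν, T h = ∫ x in s, h x ∂ν := fun h => by
    have h0 : T h = L1.integral (LpToLpRestrictCLM G A ℝ ν 1 s h) := (L1.integral_eq _).symm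
    rw [h0, L1.integral_eq_integral]
    exact integral_congr_ae (LpToLpRestrictCLM_coeFn ℝ s h)
  rw [← hT, conv_apply, ← T.integral_comp_comm hi]
  have h3 : ∫ y, T (lamA ν (f' y) (lamG ν S y g')) ∂ν = ∫ y, ∫ x in s, H y x ∂ν ∂ν := by
    refine integral_congr_ae ?_
    filter_upwards [hf'] with y hy
    rw [hT, hy]
    exact integral_congr_ae (ae_restrict_of_ae (hlam y))
  rw [h3]
  exact integral_integral_swap_of_hasCompactSupport hHc hHs

end Operators

section Crossed

variable {G : Type*} [Group G] [TopologicalSpace G] [IsTopologicalGroup G] [LocallyCompactSpace G]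
  [MeasurableSpace G] [BorelSpace G]
variable {A : Type*} [NonUnitalNormedRing A] [NormedSpace ℂ A] [IsScalarTower ℂ A A]
  [SMulCommClass ℂ A A] [CompleteSpace A] [HasCAI A]
variable {S : TwistedAction G A} {E : Type*} [NormedAddCommGroup E] [NormedSpace ℂ E]
  [CompleteSpace E]

/-- The isometry `u_x` as a bounded operator. -/
def CovariantRep.uCLM (ρ : CovariantRep S E) (x : G) : E →L[ℂ] E :=
  (ρ.u x).toContinuousLinearEquiv.toContinuousLinearMap

/-- The integrated representation `(π ⋊ u)(f) = ∫ π(f(x)) u_x dx` (as a strong integral). -/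
def CovariantRep.integrated (ρ : CovariantRep S E) (ν : Measure G) [ν.Regular] :
    Lp A 1 ν →L[ℂ] E →L[ℂ] E :=
  integratedForm ν ρ.π.toCLM ρ.uCLM ρ.continuous_u (fun x ξ => ((ρ.u x).norm_map ξ).le)

theorem CovariantRep.integrated_apply (ρ : CovariantRep S E) (ν : Measure G) [ν.Regular]
    (f : Lp A 1 ν) (ξ : E) : ρ.integrated ν f ξ = ∫ x, ρ.π (f x) (ρ.u x ξ) ∂ν := rfl

theorem CovariantRep.integrable (ρ : CovariantRep S E) (ν : Measure G) [ν.Regular]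
    (f : Lp A 1 ν) (ξ : E) : Integrable (fun x => ρ.π (f x) (ρ.u x ξ)) ν :=
  integrable_integratedForm ν ρ.π.toCLM ρ.uCLM ρ.continuous_u
    (fun x ξ => ((ρ.u x).norm_map ξ).le) f ξ

theorem CovariantRep.norm_integrated_le (ρ : CovariantRep S E) (ν : Measure G) [ν.Regular] :
    ‖ρ.integrated ν‖ ≤ ‖ρ.π.toCLM‖ :=
  norm_integratedForm_le ν _ _ _ _

theorem CovariantRep.covariant' (ρ : CovariantRep S E) (x : G) (a : A) (ξ : E) :
    ρ.π (S.α x a) (ρ.u x ξ) = ρ.u x (ρ.π a ξ) := by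
  rw [ρ.covariant, LinearIsometryEquiv.symm_apply_apply]

theorem CovariantRep.integrated_lamA (ρ : CovariantRep S E) (ν : Measure G) [ν.Regular] (a : A)
    (f : Lp A 1 ν) : ρ.integrated ν (lamA ν a f) = ρ.π a ∘L ρ.integrated ν f := by
  ext ξ
  rw [ContinuousLinearMap.comp_apply, ρ.integrated_apply, ρ.integrated_apply,
    ← (ρ.π a).integral_comp_comm (ρ.integrable ν f ξ)]
  refine integral_congr_ae ?_
  filter_upwards [lamA_coeFn ν a f] with x hx
  rw [hx, ρ.π.map_mul']
  rfl

theorem CovariantRep.integrated_rhoA (ρ : CovariantRep S E) (ν : Measure G) [ν.Regular] (a : A)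
    (f : Lp A 1 ν) : ρ.integrated ν (rhoA ν S a f) = ρ.integrated ν f ∘L ρ.π a := by
  ext ξ
  rw [ContinuousLinearMap.comp_apply, ρ.integrated_apply, ρ.integrated_apply]
  refine integral_congr_ae ?_
  filter_upwards [rhoA_coeFn ν S a f] with x hx
  rw [hx, ρ.π.map_mul', ContinuousLinearMap.comp_apply, ρ.covariant']

theorem CovariantRep.π_σ_snd (ρ : CovariantRep S E) (x y : G) (a : A) (ξ : E) :
    ρ.π ((S.σ x y : 𝓜(ℂ, A)).snd a) (ρ.u (x * y) ξ) = ρ.π a (ρ.u x (ρ.u y ξ)) := by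
  rw [ρ.u_mul, ρ.π.apply_hat]

theorem CovariantRep.integrated_lamG (ρ : CovariantRep S E) (ν : Measure G) [ν.IsHaarMeasure]
    [ν.Regular] (y : G) (f : Lp A 1 ν) :
    ρ.integrated ν (lamG ν S y f) = ρ.uCLM y ∘L ρ.integrated ν f := by
  ext ξ
  rw [ContinuousLinearMap.comp_apply, ρ.integrated_apply, ρ.integrated_apply,
    ← (ρ.uCLM y).integral_comp_comm (ρ.integrable ν f ξ)]
  have h1 : ∫ x, ρ.π (lamG ν S y f x) (ρ.u x ξ) ∂ν =
      ∫ x, ρ.π ((S.σ y (y⁻¹ * x) : 𝓜(ℂ, A)).snd (S.α y (f (y⁻¹ * x))))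
        (ρ.u (y * (y⁻¹ * x)) ξ) ∂ν := by
    refine integral_congr_ae ?_
    filter_upwards [lamG_coeFn ν S y f] with x hx
    rw [hx, mul_inv_cancel_left]
  rw [h1, integral_mul_left_eq_self
    (fun x => ρ.π ((S.σ y x : 𝓜(ℂ, A)).snd (S.α y (f x))) (ρ.u (y * x) ξ)) y⁻¹]
  refine integral_congr_ae (Eventually.of_forall fun x => ?_)
  show _ = ρ.u y _
  simp only
  rw [ρ.π_σ_snd, ρ.covariant']

theorem CovariantRep.integrated_rhoG (ρ : CovariantRep S E) (ν : Measure G) [ν.IsHaarMeasure]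
    [ν.Regular] (y : G) (f : Lp A 1 ν) :
    ρ.integrated ν (rhoG ν S y f) = ρ.integrated ν f ∘L ρ.uCLM y := by
  ext ξ
  rw [ContinuousLinearMap.comp_apply, ρ.integrated_apply, ρ.integrated_apply]
  have h1 : ∫ x, ρ.π (rhoG ν S y f x) (ρ.u x ξ) ∂ν =
      ∫ x, (fun z => ((modular y⁻¹ : ℝ) : ℂ) • ρ.π ((S.σ z y : 𝓜(ℂ, A)).snd (f z))
        (ρ.u (z * y) ξ)) (Homeomorph.mulRight y⁻¹ x) ∂ν := by
    refine integral_congr_ae ?_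
    filter_upwards [rhoG_coeFn ν S y f] with x hx
    rw [hx, Homeomorph.coe_mulRight, inv_mul_cancel_right, map_smul, smul_apply]
  rw [h1]
  refine (integral_comp (Homeomorph.mulRight y⁻¹) (modular y)
    (by simpa using map_mulRight_eq ν y⁻¹) (fun z => ((modular y⁻¹ : ℝ) : ℂ) •
      ρ.π ((S.σ z y : 𝓜(ℂ, A)).snd (f z)) (ρ.u (z * y) ξ))).trans ?_
  rw [integral_smul, ← Complex.coe_smul, smul_smul]
  have h2 : ((modular y : ℝ) : ℂ) * ((modular y⁻¹ : ℝ) : ℂ) = 1 := by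
    rw [← Complex.ofReal_mul, ← NNReal.coe_mul, modular_mul_inv]
    simp
  rw [h2, one_smul]
  refine integral_congr_ae (Eventually.of_forall fun x => ?_)
  exact ρ.π_σ_snd x y _ ξ

theorem CovariantRep.integrated_conv (ρ : CovariantRep S E) (ν : Measure G) [ν.IsHaarMeasure]
    [ν.Regular] (f g : Lp A 1 ν) :
    ρ.integrated ν (conv ν S f g) = ρ.integrated ν f ∘L ρ.integrated ν g := by
  ext ξ
  rw [ContinuousLinearMap.comp_apply, ρ.integrated_apply ν f]
  have hi : Integrable (fun y => lamA ν (f y) (lamG ν S y g)) ν :=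
    integrable_integratedForm ν (lamACLM ν) (lamG ν S) (continuous_lamG ν S)
      (norm_lamG_apply_le ν S) f g
  have h := ((ρ.integrated ν).flip ξ).integral_comp_comm hi
  rw [conv_apply]
  rw [ContinuousLinearMap.flip_apply] at h
  rw [← h]
  refine integral_congr_ae (Eventually.of_forall fun y => ?_)
  simp only [ContinuousLinearMap.flip_apply]
  rw [ρ.integrated_lamA, ρ.integrated_lamG]
  rfl

/-- The seminorm `‖f‖_R = sup {‖(π ⋊ u)(f)‖ : (π, u) ∈ R}` on `L¹(G; A)`. -/
def rNorm (ν : Measure G) [ν.Regular] (R : Set (BundledCovariantRep S)) (f : Lp A 1 ν) : ℝ :=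
  ⨆ ρ : R, ‖ρ.1.rep.integrated ν f‖

/-- The class `R` of covariant representations is uniformly bounded:
`sup {‖π‖ : (π, u) ∈ R} < ∞`. -/
def UniformlyBounded (R : Set (BundledCovariantRep S)) : Prop :=
  ∃ C : ℝ, ∀ ρ ∈ R, ‖ρ.rep.π.toCLM‖ ≤ C

theorem UniformlyBounded.of_contractive {R : Set (BundledCovariantRep S)}
    (h : ∀ ρ ∈ R, ‖ρ.rep.π.toCLM‖ ≤ 1) : UniformlyBounded R := ⟨1, h⟩

section RNorm

variable {ν : Measure G} [ν.Regular] {R : Set (BundledCovariantRep S)}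

theorem UniformlyBounded.bddAbove (hR : UniformlyBounded R) (f : Lp A 1 ν) :
    BddAbove (Set.range fun ρ : R => ‖ρ.1.rep.integrated ν f‖) := by
  obtain ⟨C, hC⟩ := hR
  refine ⟨C * ‖f‖, ?_⟩
  rintro _ ⟨ρ, rfl⟩
  refine (ContinuousLinearMap.le_opNorm _ _).trans ?_
  gcongr
  exact (ρ.1.rep.norm_integrated_le ν).trans (hC ρ.1 ρ.2)

theorem UniformlyBounded.le_rNorm (hR : UniformlyBounded R) (f : Lp A 1 ν)
    {ρ : BundledCovariantRep S} (hρ : ρ ∈ R) : ‖ρ.rep.integrated ν f‖ ≤ rNorm ν R f :=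
  le_ciSup (hR.bddAbove f) ⟨ρ, hρ⟩

theorem rNorm_le {f : Lp A 1 ν} {C : ℝ} (hC : 0 ≤ C)
    (h : ∀ ρ ∈ R, ‖ρ.rep.integrated ν f‖ ≤ C) : rNorm ν R f ≤ C :=
  Real.iSup_le (fun ρ => h ρ.1 ρ.2) hC

theorem rNorm_nonneg (f : Lp A 1 ν) : 0 ≤ rNorm ν R f :=
  Real.iSup_nonneg fun _ => norm_nonneg _

theorem rNorm_eq_zero {f : Lp A 1 ν} (h : ∀ ρ ∈ R, ρ.rep.integrated ν f = 0) : rNorm ν R f = 0 :=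
  le_antisymm (rNorm_le le_rfl fun ρ hρ => by rw [h ρ hρ, norm_zero]) (rNorm_nonneg f)

/-- `rNorm` as a bundled seminorm. -/
def rSeminorm (ν : Measure G) [ν.Regular] (hR : UniformlyBounded R) : Seminorm ℂ (Lp A 1 ν) :=
  Seminorm.of (rNorm ν R)
    (fun f g => rNorm_le (add_nonneg (rNorm_nonneg f) (rNorm_nonneg g)) fun ρ hρ => by
      rw [map_add]
      exact (norm_add_le _ _).trans (add_le_add (hR.le_rNorm f hρ) (hR.le_rNorm g hρ)))
    (fun k f => by
      rw [rNorm, rNorm, Real.mul_iSup_of_nonneg (norm_nonneg k)]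
      simp_rw [map_smul, norm_smul])

end RNorm

section Completion

variable {R : Set (BundledCovariantRep S)}

/-- The space `L¹(G; A)` with the seminorm `‖·‖_R`. -/
def SeminormedL1 (ν : Measure G) [ν.Regular] (_hR : UniformlyBounded R) : Type _ := Lp A 1 ν

section
variable (ν : Measure G) [ν.Regular] (hR : UniformlyBounded R)

instance : AddCommGroup (SeminormedL1 ν hR) := inferInstanceAs (AddCommGroup (Lp A 1 ν))

instance : Module ℂ (SeminormedL1 ν hR) := inferInstanceAs (Module ℂ (Lp A 1 ν))

instance : SeminormedAddCommGroup (SeminormedL1 ν hR) :=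
  AddGroupSeminorm.toSeminormedAddCommGroup (E := SeminormedL1 ν hR)
    (rSeminorm ν hR).toAddGroupSeminorm

theorem SeminormedL1.norm_def (f : Lp A 1 ν) :
    ‖(show SeminormedL1 ν hR from f)‖ = rNorm ν R f := rfl

instance : NormedSpace ℂ (SeminormedL1 ν hR) where
  norm_smul_le k f := (map_smul_eq_mul (rSeminorm ν hR) k f).le

/-- The underlying Banach space of the twisted crossed product `F_R(G, A, α, σ)`: the Hausdorff
completion of `L¹(G, A, α, σ)` in the seminorm `‖·‖_R`. -/
def CrossedProduct : Type _ := UniformSpace.Completion (SeminormedL1 ν hR)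

instance : NormedAddCommGroup (CrossedProduct ν hR) :=
  inferInstanceAs (NormedAddCommGroup (UniformSpace.Completion (SeminormedL1 ν hR)))

instance : NormedSpace ℂ (CrossedProduct ν hR) :=
  inferInstanceAs (NormedSpace ℂ (UniformSpace.Completion (SeminormedL1 ν hR)))

instance : CompleteSpace (CrossedProduct ν hR) :=
  inferInstanceAs (CompleteSpace (UniformSpace.Completion (SeminormedL1 ν hR)))

/-- The canonical map `τ_R : L¹(G, A, α, σ) → F_R(G, A, α, σ)`. -/
def tau : Lp A 1 ν →ₗ[ℂ] CrossedProduct ν hR :=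
  (UniformSpace.Completion.toComplₗᵢ (𝕜 := ℂ) (E := SeminormedL1 ν hR)).toLinearMap

theorem norm_tau (f : Lp A 1 ν) : ‖tau ν hR f‖ = rNorm ν R f :=
  (UniformSpace.Completion.toComplₗᵢ (𝕜 := ℂ) (E := SeminormedL1 ν hR)).norm_map f

theorem denseRange_tau : DenseRange (tau ν hR) :=
  UniformSpace.Completion.denseRange_coe (α := SeminormedL1 ν hR)

theorem tau_eq_of_integrated_eq {f g : Lp A 1 ν}
    (h : ∀ ρ ∈ R, ρ.rep.integrated ν f = ρ.rep.integrated ν g) : tau ν hR f = tau ν hR g := by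
  rw [← sub_eq_zero, ← map_sub, ← norm_eq_zero, norm_tau]
  exact rNorm_eq_zero fun ρ hρ => by rw [map_sub, h ρ hρ, sub_self]

/-- The bounded operator on `F_R(G, A, α, σ)` that extends an `‖·‖_R`-bounded operator `T` on
`L¹(G; A)`. -/
def extendOp (T : Lp A 1 ν →L[ℂ] Lp A 1 ν) : CrossedProduct ν hR →L[ℂ] CrossedProduct ν hR :=
  (tau ν hR ∘ₗ T.toLinearMap).extendOfNorm (tau ν hR)

theorem extendOp_tau (T : Lp A 1 ν →L[ℂ] Lp A 1 ν) (C : ℝ)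
    (hT : ∀ ρ ∈ R, ∀ f, ‖ρ.rep.integrated ν (T f)‖ ≤ C * ‖ρ.rep.integrated ν f‖) (f : Lp A 1 ν) :
    extendOp ν hR T (tau ν hR f) = tau ν hR (T f) := by
  refine LinearMap.extendOfNorm_eq (f := tau ν hR ∘ₗ T.toLinearMap) (denseRange_tau ν hR)
    ⟨max C 0, fun g => ?_⟩ f
  show ‖tau ν hR (T g)‖ ≤ _
  rw [norm_tau, norm_tau]
  refine rNorm_le (mul_nonneg (le_max_right _ _) (rNorm_nonneg g)) fun ρ hρ => ?_
  refine (hT ρ hρ g).trans ?_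
  exact mul_le_mul (le_max_left _ _) (hR.le_rNorm g hρ) (norm_nonneg _) (le_max_right _ _)

end

variable (ν : Measure G) [ν.IsHaarMeasure] [ν.Regular] (hR : UniformlyBounded R)

theorem rNorm_conv_le {ν : Measure G} [ν.IsHaarMeasure] [ν.Regular] (hR : UniformlyBounded R)
    (f g : Lp A 1 ν) :
    rNorm ν R (conv ν S f g) ≤ rNorm ν R f * rNorm ν R g :=
  rNorm_le (mul_nonneg (rNorm_nonneg f) (rNorm_nonneg g)) fun ρ hρ => by
    rw [ρ.rep.integrated_conv]
    exact (ContinuousLinearMap.opNorm_comp_le _ _).trans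
      (mul_le_mul (hR.le_rNorm f hρ) (hR.le_rNorm g hρ) (norm_nonneg _) (rNorm_nonneg f))

theorem extendOp_conv_tau (f g : Lp A 1 ν) :
    extendOp ν hR (conv ν S f) (tau ν hR g) = tau ν hR (conv ν S f g) := by
  refine LinearMap.extendOfNorm_eq (f := tau ν hR ∘ₗ (conv ν S f).toLinearMap)
    (denseRange_tau ν hR) ⟨rNorm ν R f, fun g => ?_⟩ g
  show ‖tau ν hR (conv ν S f g)‖ ≤ _
  rw [norm_tau, norm_tau]
  exact rNorm_conv_le hR f g

/-- Left convolution `f ↦ (τ_R(g) ↦ τ_R(f * g))` as a linear map `L¹(G; A) → B(F_R(G, A, α, σ))`. -/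
def convLeft : Lp A 1 ν →ₗ[ℂ] CrossedProduct ν hR →L[ℂ] CrossedProduct ν hR where
  toFun f := extendOp ν hR (conv ν S f)
  map_add' f g := by
    ext c
    refine (denseRange_tau ν hR).induction_on (p := fun c => extendOp ν hR (conv ν S (f + g)) c =
      (extendOp ν hR (conv ν S f) + extendOp ν hR (conv ν S g)) c) c ?_ fun h => ?_
    · exact isClosed_eq (ContinuousLinearMap.continuous _) (ContinuousLinearMap.continuous _)
    · show _ = extendOp ν hR (conv ν S f) (tau ν hR h) + extendOp ν hR (conv ν S g) (tau ν hR h)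
      rw [extendOp_conv_tau, extendOp_conv_tau, extendOp_conv_tau, map_add, add_apply, map_add]
  map_smul' k f := by
    ext c
    refine (denseRange_tau ν hR).induction_on (p := fun c => extendOp ν hR (conv ν S (k • f)) c =
      (k • extendOp ν hR (conv ν S f)) c) c ?_ fun h => ?_
    · exact isClosed_eq (ContinuousLinearMap.continuous _) (ContinuousLinearMap.continuous _)
    · show _ = k • extendOp ν hR (conv ν S f) (tau ν hR h)
      rw [extendOp_conv_tau, extendOp_conv_tau, map_smul, smul_apply, map_smul]

theorem norm_convLeft_le (f : Lp A 1 ν) : ‖convLeft ν hR f‖ ≤ ‖tau ν hR f‖ := by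
  refine ContinuousLinearMap.opNorm_le_bound _ (norm_nonneg _) fun c => ?_
  refine (denseRange_tau ν hR).induction_on
    (p := fun c => ‖convLeft ν hR f c‖ ≤ ‖tau ν hR f‖ * ‖c‖) c ?_ fun g => ?_
  · exact isClosed_le (ContinuousLinearMap.continuous _).norm (by fun_prop)
  · show ‖extendOp ν hR (conv ν S f) (tau ν hR g)‖ ≤ _
    rw [extendOp_conv_tau, norm_tau, norm_tau, norm_tau]
    exact rNorm_conv_le hR f g

/-- The multiplication of `F_R(G, A, α, σ)`, the continuous bilinear extension of the twisted
convolution. -/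
def mulCLM : CrossedProduct ν hR →L[ℂ] CrossedProduct ν hR →L[ℂ] CrossedProduct ν hR :=
  (convLeft ν hR).extendOfNorm (tau ν hR)

theorem mulCLM_tau (f g : Lp A 1 ν) :
    mulCLM ν hR (tau ν hR f) (tau ν hR g) = tau ν hR (conv ν S f g) := by
  rw [mulCLM, LinearMap.extendOfNorm_eq (denseRange_tau ν hR)
    ⟨1, fun f => by rw [one_mul]; exact norm_convLeft_le ν hR f⟩]
  exact extendOp_conv_tau ν hR f g

theorem norm_mulCLM_apply_le (c d : CrossedProduct ν hR) : ‖mulCLM ν hR c d‖ ≤ ‖c‖ * ‖d‖ := by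
  refine (denseRange_tau ν hR).induction_on₂
    (p := fun c d => ‖mulCLM ν hR c d‖ ≤ ‖c‖ * ‖d‖) ?_ (fun f g => ?_) c d
  · exact isClosed_le (by fun_prop) (by fun_prop)
  · rw [mulCLM_tau, norm_tau, norm_tau, norm_tau]
    exact rNorm_conv_le hR f g

instance : Mul (CrossedProduct ν hR) := ⟨fun c d => mulCLM ν hR c d⟩

theorem mul_def' (c d : CrossedProduct ν hR) : c * d = mulCLM ν hR c d := rfl

theorem tau_mul_tau (f g : Lp A 1 ν) : tau ν hR f * tau ν hR g = tau ν hR (conv ν S f g) :=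
  mulCLM_tau ν hR f g

theorem continuous_mul_crossedProduct :
    Continuous fun p : CrossedProduct ν hR × CrossedProduct ν hR => p.1 * p.2 := by
  simp only [mul_def']
  fun_prop

theorem crossedProduct_mul_assoc (a b c : CrossedProduct ν hR) : a * b * c = a * (b * c) := by
  have hm := continuous_mul_crossedProduct ν hR
  refine (denseRange_tau ν hR).induction_on₃
    (p := fun a b c => a * b * c = a * (b * c)) ?_ (fun f g h => ?_) a b c
  · simp only [mul_def']
    exact isClosed_eq (by fun_prop) (by fun_prop)
  · simp only [tau_mul_tau]
    refine tau_eq_of_integrated_eq ν hR fun ρ _ => ?_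
    simp only [ρ.rep.integrated_conv, ContinuousLinearMap.comp_assoc]

/-- `F_R(G, A, α, σ)` as a Banach algebra. -/
instance : NonUnitalNormedRing (CrossedProduct ν hR) :=
  { (inferInstance : NormedAddCommGroup (CrossedProduct ν hR)),
    (inferInstance : Mul (CrossedProduct ν hR)) with
    left_distrib := fun a b c => map_add (mulCLM ν hR a) b c
    right_distrib := fun a b c => by
      show mulCLM ν hR (a + b) c = mulCLM ν hR a c + mulCLM ν hR b c
      rw [map_add, add_apply]
    zero_mul := fun a => by
      show mulCLM ν hR 0 a = 0
      rw [map_zero, zero_apply]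
    mul_zero := fun a => map_zero (mulCLM ν hR a)
    mul_assoc := crossedProduct_mul_assoc ν hR
    norm_mul_le := norm_mulCLM_apply_le ν hR }

instance : IsScalarTower ℂ (CrossedProduct ν hR) (CrossedProduct ν hR) where
  smul_assoc k a b := by
    show mulCLM ν hR (k • a) b = k • mulCLM ν hR a b
    rw [map_smul, smul_apply]

instance : SMulCommClass ℂ (CrossedProduct ν hR) (CrossedProduct ν hR) where
  smul_comm k a b := by
    show k • mulCLM ν hR a b = mulCLM ν hR a (k • b)
    rw [map_smul]

theorem extendOp_central (L T : Lp A 1 ν →L[ℂ] Lp A 1 ν) (C : ℝ)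
    (hL : ∀ ρ ∈ R, ∀ f, ‖ρ.rep.integrated ν (L f)‖ ≤ C * ‖ρ.rep.integrated ν f‖)
    (hT : ∀ ρ ∈ R, ∀ f, ‖ρ.rep.integrated ν (T f)‖ ≤ C * ‖ρ.rep.integrated ν f‖)
    (h : ∀ ρ ∈ R, ∀ f g, ρ.rep.integrated ν (T f) ∘L ρ.rep.integrated ν g =
      ρ.rep.integrated ν f ∘L ρ.rep.integrated ν (L g)) (c d : CrossedProduct ν hR) :
    extendOp ν hR T c * d = c * extendOp ν hR L d := by
  refine (denseRange_tau ν hR).induction_on₂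
    (p := fun c d => extendOp ν hR T c * d = c * extendOp ν hR L d) ?_ (fun f g => ?_) c d
  · simp only [mul_def']
    exact isClosed_eq (by fun_prop) (by fun_prop)
  · rw [extendOp_tau ν hR T C hT, extendOp_tau ν hR L C hL, tau_mul_tau, tau_mul_tau]
    refine tau_eq_of_integrated_eq ν hR fun ρ hρ => ?_
    rw [ρ.rep.integrated_conv, ρ.rep.integrated_conv, h ρ hρ]

/-- The canonical map `(λ_A^R, ρ_A^R) : A → M(F_R(G, A, α, σ))`. -/
def canonicalA (a : A) : 𝓜(ℂ, CrossedProduct ν hR) where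
  fst := extendOp ν hR (lamA ν a)
  snd := extendOp ν hR (rhoA ν S a)
  central := by
    obtain ⟨C, hC⟩ := id hR
    have hb : ∀ ρ ∈ R, ‖ρ.rep.π a‖ ≤ C * ‖a‖ := fun ρ hρ =>
      (ρ.rep.π.toCLM.le_opNorm a).trans (by gcongr; exact hC ρ hρ)
    refine extendOp_central ν hR (lamA ν a) (rhoA ν S a) (C * ‖a‖) ?_ ?_ ?_
    · intro ρ hρ f
      rw [ρ.rep.integrated_lamA]
      exact (ContinuousLinearMap.opNorm_comp_le _ _).trans (by gcongr; exact hb ρ hρ)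
    · intro ρ hρ f
      rw [ρ.rep.integrated_rhoA, mul_comm]
      exact (ContinuousLinearMap.opNorm_comp_le _ _).trans (by gcongr; exact hb ρ hρ)
    · intro ρ _ f g
      rw [ρ.rep.integrated_lamA, ρ.rep.integrated_rhoA, ContinuousLinearMap.comp_assoc]

theorem CovariantRep.norm_uCLM_le (ρ : CovariantRep S E) (y : G) : ‖ρ.uCLM y‖ ≤ 1 :=
  ContinuousLinearMap.opNorm_le_bound _ zero_le_one fun ξ => by
    rw [one_mul]
    exact ((ρ.u y).norm_map ξ).le

/-- The canonical map `(λ_G^R, ρ_G^R) : G → M(F_R(G, A, α, σ))`. -/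
def canonicalG (y : G) : 𝓜(ℂ, CrossedProduct ν hR) where
  fst := extendOp ν hR (lamG ν S y)
  snd := extendOp ν hR (rhoG ν S y)
  central := by
    refine extendOp_central ν hR (lamG ν S y) (rhoG ν S y) 1 ?_ ?_ ?_
    · intro ρ hρ f
      rw [ρ.rep.integrated_lamG]
      exact (ContinuousLinearMap.opNorm_comp_le _ _).trans
        (by gcongr; exact ρ.rep.norm_uCLM_le y)
    · intro ρ hρ f
      rw [ρ.rep.integrated_rhoG, mul_comm]
      exact (ContinuousLinearMap.opNorm_comp_le _ _).trans
        (by gcongr; exact ρ.rep.norm_uCLM_le y)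
    · intro ρ _ f g
      rw [ρ.rep.integrated_lamG, ρ.rep.integrated_rhoG, ContinuousLinearMap.comp_assoc]

end Completion

end Crossed

end TwistedBanach

end

open TwistedBanach

namespace TwistedBanach

/-! A contractive approximate identity makes left multiplication an isometric embedding of `B` into
the bounded operators on `B` (`norm_mulLeft_eq`). An element of `B` is thus the same thing as its
left multiplication operator, with the same norm. Every integrated operator `(k_A ⋊ k_G)(f)` is left
multiplication by a unique `φ(f)`, and `‖φ(f)‖ = ‖f‖_R = ‖τ(f)‖`, where `τ` is the canonical map
from `L¹` to `F_R`. Both `φ` and `τ` have dense range in a Banach space, so `φ` factors through `τ`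
by an isometric bijection `Ψ` (`exists_linearIsometryEquiv_of_dense`). It is multiplicative because
integrated forms turn twisted convolution into composition.

The extension of `Ψ` has the required values because the integrated form of any covariant
representation turns `λ_A(a)` and `λ_G(y)` into composition on the left with `π(a)` and `u_y`, and
`ρ_A(a)` and `ρ_G(y)` into composition on the right with them. For the representation on `B` these
operators are the left actions of `k_A(a)` and `k_G(y)` (`eq_hat_canonicalA`, `eq_hat_canonicalG`).

Uniqueness rests on `f * g = ∫ λ_A(f(y)) λ_G(y) g dy`. If the extension of `Ψ'` takes the prescribed
values, applying `Ψ' ∘ τ` under the integral gives `Ψ'(τ f) Ψ'(τ g) = ∫ k_A(f(y)) k_G(y) Ψ'(τ g)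
dy`. Left multiplication by `Ψ'(τ f)` is therefore `(k_A ⋊ k_G)(f)` (`apply_tau_mul_eq_integrated`),
which determines `Ψ'` on the dense range of `τ`. -/

/-! ### Left multiplication on an algebra with a contractive approximate identity -/

/-- For the lower bound, `b * e` tends to `b` along the approximate identity, while contractivity of
`e` keeps `‖b * e‖` below the operator norm. -/
theorem norm_mulLeft_eq {B : Type*} [NonUnitalNormedRing B] [NormedSpace ℂ B]
    [IsScalarTower ℂ B B] [SMulCommClass ℂ B B] [HasCAI B] (b : B) :
    ‖ContinuousLinearMap.mul ℂ B b‖ = ‖b‖ := by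
  refine le_antisymm (ContinuousLinearMap.opNorm_mul_apply_le ℂ B b) ?_
  obtain ⟨l, hl, hb, -, h⟩ := HasCAI.exists_cai (A := B)
  refine le_of_tendsto (h b).norm (hb.mono fun e he => ?_)
  refine ((ContinuousLinearMap.mul ℂ B b).le_opNorm e).trans ?_
  exact mul_le_of_le_one_right (norm_nonneg _) he

/-- This lets identities in `B` be tested after multiplying on the right by an arbitrary `d`, where
they become identities between operators on `B`. -/
theorem mulLeft_injective {B : Type*} [NonUnitalNormedRing B] [NormedSpace ℂ B]
    [IsScalarTower ℂ B B] [SMulCommClass ℂ B B] [HasCAI B] {b c : B}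
    (h : ∀ d, b * d = c * d) : b = c := by
  rw [← sub_eq_zero, ← norm_eq_zero, ← norm_mulLeft_eq, norm_eq_zero]
  ext d
  simp [h d]

/-! ### Extension and uniqueness by density -/

/-- A linear map `φ` into a Banach space with dense range, which has the same norms as a linear
map `τ` with dense range, factors through `τ` by an isometric isomorphism. -/
theorem exists_linearIsometryEquiv_of_dense {X F B : Type*} [AddCommGroup X] [Module ℂ X]
    [NormedAddCommGroup F] [NormedSpace ℂ F] [CompleteSpace F] [NormedAddCommGroup B]
    [NormedSpace ℂ B] [CompleteSpace B] (τ : X →ₗ[ℂ] F) (φ : X →ₗ[ℂ] B) (hτ : DenseRange τ)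
    (hφ : DenseRange φ) (h : ∀ x, ‖φ x‖ = ‖τ x‖) : ∃ Ψ : F ≃ₗᵢ[ℂ] B, ∀ x, Ψ (τ x) = φ x := by
  have hΨ : ∀ x, φ.extendOfNorm τ (τ x) = φ x := fun x =>
    LinearMap.extendOfNorm_eq hτ ⟨1, fun y => by rw [one_mul, h]⟩ x
  let Ψ : F →ₗᵢ[ℂ] B :=
    { toLinearMap := (φ.extendOfNorm τ).toLinearMap
      norm_map' := fun c => hτ.induction_on (p := fun c => ‖φ.extendOfNorm τ c‖ = ‖c‖) c
        (isClosed_eq (ContinuousLinearMap.continuous _).norm continuous_norm)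
        fun x => by rw [hΨ, h] }
  -- An isometric image of the complete space `F` is closed. It contains the range of `φ`, so
  -- density of the latter forces surjectivity.
  have hr : IsClosed (Set.range Ψ) := Ψ.isometry.isClosedEmbedding.isClosed_range
  have hs : Function.Surjective Ψ := fun b => by
    have h1 : Set.range φ ⊆ Set.range Ψ := by
      rintro _ ⟨x, rfl⟩
      exact ⟨τ x, hΨ x⟩
    exact hr.closure_subset_iff.2 h1 (hφ b)
  exact ⟨LinearIsometryEquiv.ofSurjective Ψ hs, hΨ⟩

theorem isometricIso_ext_of_dense {F B : Type*} [NonUnitalNormedRing F] [NormedSpace ℂ F]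
    [NonUnitalNormedRing B] [NormedSpace ℂ B] {Ψ Ψ' : IsometricIso F B} {s : Set F} (hs : Dense s)
    (h : ∀ c ∈ s, Ψ c = Ψ' c) : Ψ = Ψ' := by
  have h1 : Ψ.toLinearIsometryEquiv = Ψ'.toLinearIsometryEquiv :=
    DFunLike.coe_injective (Continuous.ext_on hs Ψ.toLinearIsometryEquiv.continuous
      Ψ'.toLinearIsometryEquiv.continuous h)
  -- Multiplicativity is a proposition, so agreement of the underlying linear isometric equivalences
  -- is enough.
  cases Ψ
  cases Ψ'
  cases h1
  rfl

/-! ### The canonical maps on the image of `L¹` -/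

section Canonical

variable {G : Type*} [Group G] [TopologicalSpace G] [IsTopologicalGroup G] [LocallyCompactSpace G]
  [MeasurableSpace G] [BorelSpace G] (ν : Measure G) [ν.IsHaarMeasure] [ν.Regular]
variable {A : Type*} [NonUnitalNormedRing A] [NormedSpace ℂ A] [IsScalarTower ℂ A A]
  [SMulCommClass ℂ A A] [CompleteSpace A] [HasCAI A]
variable {S : TwistedAction G A} {R : Set (BundledCovariantRep.{w} S)} (hR : UniformlyBounded R)

/-- The `L¹` norm dominates `‖·‖_R` up to a bound for the `‖π‖`. Continuity is needed to move `tau`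
inside a Bochner integral in the uniqueness argument. -/
theorem continuous_tau : Continuous (tau ν hR) := by
  obtain ⟨C, hC⟩ := id hR
  -- `UniformlyBounded` says nothing about the sign of `C`, which may be negative if `R` is empty;
  -- the maximum with `0` covers this.
  refine AddMonoidHomClass.continuous_of_bound (tau ν hR) (max C 0) fun f => ?_
  rw [norm_tau]
  refine rNorm_le (by positivity) fun ρ hρ => (ContinuousLinearMap.le_opNorm _ _).trans ?_
  gcongr
  exact ((ρ.rep.norm_integrated_le ν).trans (hC ρ hρ)).trans (le_max_left _ _)

/-- `extendOp` is known to extend an operator only once that operator is bounded for `‖·‖_R`. Each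
integrated form turns `λ_A(a)` into left composition with `π(a)`, of norm at most `C * ‖a‖`
uniformly over `R`. -/
theorem canonicalA_fst_tau (a : A) (f : Lp A 1 ν) :
    (canonicalA ν hR a).fst (tau ν hR f) = tau ν hR (lamA ν a f) := by
  obtain ⟨C, hC⟩ := id hR
  refine extendOp_tau ν hR _ (C * ‖a‖) (fun ρ hρ f => ?_) f
  rw [ρ.rep.integrated_lamA]
  refine (ContinuousLinearMap.opNorm_comp_le _ _).trans ?_
  gcongr
  exact (ρ.rep.π.toCLM.le_opNorm a).trans (by gcongr; exact hC ρ hρ)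

theorem canonicalA_snd_tau (a : A) (f : Lp A 1 ν) :
    (canonicalA ν hR a).snd (tau ν hR f) = tau ν hR (rhoA ν S a f) := by
  obtain ⟨C, hC⟩ := id hR
  refine extendOp_tau ν hR _ (C * ‖a‖) (fun ρ hρ f => ?_) f
  -- Here `π(a)` is composed on the right, so the factors of the bound are swapped to match the
  -- order of composition.
  rw [ρ.rep.integrated_rhoA, mul_comm]
  refine (ContinuousLinearMap.opNorm_comp_le _ _).trans ?_
  gcongr
  exact (ρ.rep.π.toCLM.le_opNorm a).trans (by gcongr; exact hC ρ hρ)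

/-- The constant is `1` because the operators `u_y` are isometries. -/
theorem canonicalG_fst_tau (y : G) (f : Lp A 1 ν) :
    (canonicalG ν hR y).fst (tau ν hR f) = tau ν hR (lamG ν S y f) := by
  refine extendOp_tau ν hR _ 1 (fun ρ hρ f => ?_) f
  rw [ρ.rep.integrated_lamG]
  exact (ContinuousLinearMap.opNorm_comp_le _ _).trans (by gcongr; exact ρ.rep.norm_uCLM_le y)

theorem canonicalG_snd_tau (y : G) (f : Lp A 1 ν) :
    (canonicalG ν hR y).snd (tau ν hR f) = tau ν hR (rhoG ν S y f) := by
  refine extendOp_tau ν hR _ 1 (fun ρ hρ f => ?_) f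
  rw [ρ.rep.integrated_rhoG, mul_comm]
  exact (ContinuousLinearMap.opNorm_comp_le _ _).trans (by gcongr; exact ρ.rep.norm_uCLM_le y)

/-! ### Testing on the image of `L¹`, and the uniqueness argument -/

variable {B : Type*} [NonUnitalNormedRing B] [NormedSpace ℂ B] [IsScalarTower ℂ B B]
  [SMulCommClass ℂ B B]

/-- To identify `Ψ̂(T)` it suffices to test on the dense image of `L¹(G; A)`. -/
theorem eq_hat_of_tau (Ψ : IsometricIso (CrossedProduct ν hR) B) (T : 𝓜(ℂ, B))
    (T' : 𝓜(ℂ, CrossedProduct ν hR))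
    (h1 : ∀ f, T.fst (Ψ (tau ν hR f)) = Ψ (T'.fst (tau ν hR f)))
    (h2 : ∀ f, T.snd (Ψ (tau ν hR f)) = Ψ (T'.snd (tau ν hR f))) : T = Ψ.hat T' := by
  have hd : DenseRange fun f => Ψ (tau ν hR f) :=
    Ψ.toLinearIsometryEquiv.surjective.denseRange.comp (denseRange_tau ν hR)
      Ψ.toLinearIsometryEquiv.continuous
  -- A double centralizer is its pair of bounded maps, so each half is compared by continuity on the
  -- dense set of the elements `Ψ (tau ν hR f)`.
  refine DoubleCentralizer.ext ℂ B _ _ (Prod.ext ?_ ?_)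
  · refine DFunLike.coe_injective (hd.equalizer T.fst.continuous (Ψ.hat T').fst.continuous ?_)
    funext f
    exact (h1 f).trans (Ψ.hat_fst_apply T' _).symm
  · refine DFunLike.coe_injective (hd.equalizer T.snd.continuous (Ψ.hat T').snd.continuous ?_)
    funext f
    exact (h2 f).trans (Ψ.hat_snd_apply T' _).symm

variable [CompleteSpace B]

/-- An isometric isomorphism whose extension intertwines the canonical maps with a covariant
representation on `B` is the integrated form of that representation. -/
theorem apply_tau_mul_eq_integrated (k : CovariantRep S B)
    (Ψ : IsometricIso (CrossedProduct ν hR) B)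
    (hA : ∀ a b, k.π a b = (Ψ.hat (canonicalA ν hR a)).fst b)
    (hG : ∀ x b, k.u x b = (Ψ.hat (canonicalG ν hR x)).fst b) (f : Lp A 1 ν) (b : B) :
    Ψ (tau ν hR f) * b = k.integrated ν f b := by
  -- The composite is bundled as a bounded map on `L¹` so that it commutes with Bochner integrals.
  -- Its range is dense, so it suffices to take `b = T g`.
  let T : Lp A 1 ν →L[ℂ] B := Ψ.toCLM ∘L ⟨tau ν hR, continuous_tau ν hR⟩
  have hd : DenseRange T :=
    Ψ.toLinearIsometryEquiv.surjective.denseRange.comp (denseRange_tau ν hR)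
      Ψ.toLinearIsometryEquiv.continuous
  refine hd.induction_on (p := fun b => Ψ (tau ν hR f) * b = k.integrated ν f b) b
    (isClosed_eq (continuous_const_mul _) (ContinuousLinearMap.continuous _)) fun g => ?_
  have hi : Integrable (fun y => lamA ν (f y) (lamG ν S y g)) ν :=
    integrable_integratedForm ν (lamACLM ν) (lamG ν S) (continuous_lamG ν S)
      (norm_lamG_apply_le ν S) f g
  have h : Ψ (tau ν hR f) * T g = T (conv ν S f g) := by
    change Ψ (tau ν hR f) * Ψ (tau ν hR g) = Ψ (tau ν hR (conv ν S f g))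
    rw [← tau_mul_tau, Ψ.map_mul']
  -- The product `f * g` is an `L¹`-valued integral of `λ_A(f(y)) λ_G(y) g`, so `T` passes inside
  -- and the integrands can be compared for each `y`.
  rw [h, conv_apply, ← T.integral_comp_comm hi, k.integrated_apply]
  refine integral_congr_ae (Eventually.of_forall fun y => ?_)
  change Ψ (tau ν hR (lamA ν (f y) (lamG ν S y g))) = k.π (f y) (k.u y (Ψ (tau ν hR g)))
  -- Only the left halves of the canonical multipliers enter: `k.u y` becomes `λ_G(y)` under `Ψ ∘
  -- τ`, and then `k.π (f y)` becomes `λ_A(f(y))`.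
  rw [hG, hA, Ψ.hat_fst_apply, canonicalG_fst_tau, Ψ.hat_fst_apply, canonicalA_fst_tau]

/-! ### Existence of the isomorphism and the values of its extension -/

variable [HasCAI B]

/-- If the integrated form takes values in the left multiplications, has dense range in them and is
isometric for the seminorm of `R`, then it induces an isometric isomorphism. -/
theorem exists_isometricIso_of_integrated (k : CovariantRep S B)
    (hrange : Set.range (k.integrated ν) ⊆ Set.range (ContinuousLinearMap.mul ℂ B))
    (hdense : Set.range (ContinuousLinearMap.mul ℂ B) ⊆ closure (Set.range (k.integrated ν)))
    (hiso : ∀ f : Lp A 1 ν, ‖k.integrated ν f‖ = rNorm ν R f) :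
    ∃ Ψ : IsometricIso (CrossedProduct ν hR) B,
      ∀ f b, Ψ (tau ν hR f) * b = k.integrated ν f b := by
  choose φ hφ using fun f => hrange (Set.mem_range_self f)
  have hφ' : ∀ f b, φ f * b = k.integrated ν f b := fun f b => DFunLike.congr_fun (hφ f) b
  -- The values of `φ` are chosen one at a time, but faithfulness of left multiplication makes them
  -- unique, so `φ` inherits linearity from the integrated form.
  let Φ : Lp A 1 ν →ₗ[ℂ] B :=
    { toFun := φ
      map_add' := fun f g => mulLeft_injective fun d => by
        rw [add_mul, hφ', hφ', hφ', map_add, add_apply]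
      map_smul' := fun c f => mulLeft_injective fun d => by
        rw [RingHom.id_apply, smul_mul_assoc, hφ', hφ', map_smul, smul_apply] }
  have hΦd : DenseRange Φ := fun b => by
    rw [Metric.mem_closure_iff]
    intro ε hε
    -- Density is given in operator norm; since left multiplication is isometric, the same `f` gives
    -- an equally good approximation in `B`.
    obtain ⟨_, ⟨f, rfl⟩, hf⟩ := Metric.mem_closure_iff.1 (hdense ⟨b, rfl⟩) ε hε
    refine ⟨Φ f, ⟨f, rfl⟩, ?_⟩
    have h : ContinuousLinearMap.mul ℂ B (Φ f) = k.integrated ν f := hφ f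
    rwa [dist_eq_norm, ← norm_mulLeft_eq, map_sub, h, ← dist_eq_norm]
  -- The norms agree through `‖φ f‖ = ‖k.integrated ν f‖ = ‖f‖_R = ‖τ f‖`. The representation `k`
  -- itself need not belong to `R`.
  obtain ⟨Ψ, hΨ⟩ := exists_linearIsometryEquiv_of_dense (tau ν hR) Φ (denseRange_tau ν hR) hΦd
    fun f => by rw [norm_tau, ← hiso, ← hφ, norm_mulLeft_eq]; rfl
  refine ⟨⟨Ψ, fun a b => ?_⟩, fun f b => ?_⟩
  · refine (denseRange_tau ν hR).induction_on₂ (p := fun a b => Ψ (a * b) = Ψ a * Ψ b) ?_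
      (fun f g => ?_) a b
    · have := Ψ.continuous
      exact isClosed_eq (by fun_prop) (by fun_prop)
    · rw [tau_mul_tau, hΨ, hΨ, hΨ]
      refine mulLeft_injective fun d => ?_
      change φ _ * d = φ f * φ g * d
      -- Acting on `d`, both sides are the integrated operator of `f` applied to that of `g`.
      rw [mul_assoc, hφ', hφ', hφ', k.integrated_conv]
      rfl
  · change Ψ (tau ν hR f) * b = _
    rw [hΨ]
    exact hφ' f b

/-- The hypothesis on `T` concerns its left half only, yet both halves are identified. After
multiplication by `d`, the left half is moved onto the product by `T(xd) = (Tx)d`, which gives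
`π(a)` composed before the integrated operator. For the right half the centralizer identity `(xT)d =
x(Td)` again leaves only the left action of `T`, now on the other side. -/
theorem eq_hat_canonicalA (k : CovariantRep S B) (Ψ : IsometricIso (CrossedProduct ν hR) B)
    (hΨ : ∀ f b, Ψ (tau ν hR f) * b = k.integrated ν f b) (T : 𝓜(ℂ, B)) (a : A)
    (hT : ∀ b, k.π a b = T.fst b) : T = Ψ.hat (canonicalA ν hR a) := by
  refine eq_hat_of_tau ν hR Ψ _ _ (fun f => mulLeft_injective fun d => ?_)
    (fun f => mulLeft_injective fun d => ?_)
  · rw [canonicalA_fst_tau, hΨ, k.integrated_lamA, ← fst_mul_apply, hΨ, ← hT]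
    rfl
  · rw [canonicalA_snd_tau, hΨ, k.integrated_rhoA, T.central, hΨ, ← hT]
    rfl

/-- The mechanism is that of `eq_hat_canonicalA`, with `u_x` in the place of `π(a)`. -/
theorem eq_hat_canonicalG (k : CovariantRep S B) (Ψ : IsometricIso (CrossedProduct ν hR) B)
    (hΨ : ∀ f b, Ψ (tau ν hR f) * b = k.integrated ν f b) (T : 𝓜(ℂ, B)) (x : G)
    (hT : ∀ b, k.u x b = T.fst b) : T = Ψ.hat (canonicalG ν hR x) := by
  refine eq_hat_of_tau ν hR Ψ _ _ (fun f => mulLeft_injective fun d => ?_)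
    (fun f => mulLeft_injective fun d => ?_)
  · rw [canonicalG_fst_tau, hΨ, k.integrated_lamG, ← fst_mul_apply, hΨ, ← hT]
    rfl
  · rw [canonicalG_snd_tau, hΨ, k.integrated_rhoG, T.central, hΨ, ← hT]
    rfl

end Canonical

end TwistedBanach

/-! ### The characterization of the crossed product -/

theorem mainTheorem3
    -- `G` is a locally compact group with a fixed left Haar measure `ν`
    {G : Type*} [Group G] [TopologicalSpace G] [IsTopologicalGroup G] [LocallyCompactSpace G]
    [T2Space G] [MeasurableSpace G] [BorelSpace G]
    (ν : Measure G) [ν.IsHaarMeasure] [ν.Regular]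
    -- `A` is a Banach algebra with a contractive approximate identity
    {A : Type*} [NonUnitalNormedRing A] [NormedSpace ℂ A] [IsScalarTower ℂ A A]
    [SMulCommClass ℂ A A] [CompleteSpace A] [HasCAI A]
    -- `S = (α, σ)` is a twisted action of `G` on `A`
    (S : TwistedAction G A)
    -- `R` is a nonempty class of contractive covariant representations
    (R : Set (BundledCovariantRep.{w} S)) (hRne : R.Nonempty)
    (hR : ∀ ρ ∈ R, ‖ρ.rep.π.toCLM‖ ≤ 1)
    -- `B` is a Banach algebra with a contractive approximate identity
    {B : Type*} [NonUnitalNormedRing B] [NormedSpace ℂ B] [IsScalarTower ℂ B B]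
    [SMulCommClass ℂ B B] [CompleteSpace B] [HasCAI B]
    (kA : A → 𝓜(ℂ, B)) (kG : G → 𝓜(ℂ, B))
    -- `(kA, kG)` is a covariant representation on `B`, where `T ∈ M(B)` acts on `B` as `T.fst`
    (k : CovariantRep S B)
    (hkA : ∀ a b, k.π a b = (kA a).fst b) (hkG : ∀ x b, k.u x b = (kG x).fst b)
    -- the image of `kA ⋊ kG` is a dense subset of the canonical copy of `B` in `M(B)`
    (hrange : Set.range (k.integrated ν) ⊆ Set.range fun b : B => (b : 𝓜(ℂ, B)).fst)
    (hdense : (Set.range fun b : B => (b : 𝓜(ℂ, B)).fst) ⊆ closure (Set.range (k.integrated ν)))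
    -- `kA ⋊ kG` is isometric for the seminorm `‖·‖_R`
    (hiso : ∀ f : Lp A 1 ν, ‖k.integrated ν f‖ = rNorm ν R f) :
    ∃! Ψ : IsometricIso (CrossedProduct ν (UniformlyBounded.of_contractive hR)) B,
      (∀ a, kA a = Ψ.hat (canonicalA ν (UniformlyBounded.of_contractive hR) a)) ∧
      (∀ x, kG x = Ψ.hat (canonicalG ν (UniformlyBounded.of_contractive hR) x)) := by
  -- The left half of the multiplier attached to `b` is by definition left multiplication by `b`, so
  -- the range and density hypotheses apply as they stand.
  obtain ⟨Ψ, hΨ⟩ := exists_isometricIso_of_integrated ν (UniformlyBounded.of_contractive hR) k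
    hrange hdense hiso
  refine ⟨Ψ, ⟨fun a => eq_hat_canonicalA ν _ k Ψ hΨ _ a (hkA a),
    fun x => eq_hat_canonicalG ν _ k Ψ hΨ _ x (hkG x)⟩, ?_⟩
  rintro Ψ' ⟨hA, hG⟩
  refine isometricIso_ext_of_dense (denseRange_tau ν _) ?_
  rintro _ ⟨f, rfl⟩
  -- Both isomorphisms send `τ f` to an element whose left multiplication is the integrated operator
  -- of `f`; faithfulness then identifies the two elements.
  refine mulLeft_injective fun b => ?_
  rw [hΨ]
  exact apply_tau_mul_eq_integrated ν _ k Ψ' (fun a b => by rw [hkA, hA])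
    (fun x b => by rw [hkG, hG]) f b
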